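/- A Latin square of order $n$ is an $n\times n$ matrix on $n$ symbols in which each row and each column contains each symbol exactly once; we identify it with the set of triples $(r,c,s)$ such that $s$ is the symbol in cell $(r,c)$. A partial transversal of a Latin square $L$ is a set $T$ of triples of $L$ containing at most one representative of each row, of each column and of each symbol; its length is $|T|$. It is maximal if it is not contained in a partial transversal of $L$ of greater length. A Latin square of order $n$ is called omniversal if, for every integer $\ell$ with $\lceil n/2\rceil\le \ell\le n$, it has a maximal partial transversal of length $\ell$. **Theorem.** Let $n$ be a positive integer. There exists an omniversal Latin square of order $n$ if and only if $n\notin\{3,4\}$ and $n\not\equiv 2 \pmod 4$. -/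

import Mathlib

/-- A Latin square of order `n`: an `n × n` matrix with entries among `n` symbols such that
each row and each column contains exactly one copy of each symbol. Rows, columns and symbols
are indexed by `Fin n`. -/
structure LatinSquare (n : ℕ) where
  /-- The underlying matrix. -/
  entry : Matrix (Fin n) (Fin n) (Fin n)
  /-- Each symbol `s` occurs exactly once in each row `r`. -/
  row_latin : ∀ r s, ∃! c, entry r c = s
  /-- Each symbol `s` occurs exactly once in each column `c`. -/
  col_latin : ∀ c s, ∃! r, entry r c = s

namespace LatinSquare

variable {n : ℕ}

/-- The set of triples `(r, c, s)` with `s` the symbol in cell `(r, c)`. -/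
def triples (L : LatinSquare n) : Set (Fin n × Fin n × Fin n) :=
  {t | L.entry t.1 t.2.1 = t.2.2}

/-- A partial transversal: a set of triples of `L` containing at most one representative of each
row, of each column and of each symbol. Its length is the cardinality of `T`. -/
structure IsPartialTransversal (L : LatinSquare n) (T : Finset (Fin n × Fin n × Fin n)) :
    Prop where
  /-- Every element of `T` is a triple of `L`. -/
  subset : ∀ t ∈ T, t ∈ L.triples
  /-- At most one representative of each row. -/
  row : ∀ t ∈ T, ∀ u ∈ T, t.1 = u.1 → t = u
  /-- At most one representative of each column. -/
  col : ∀ t ∈ T, ∀ u ∈ T, t.2.1 = u.2.1 → t = u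
  /-- At most one representative of each symbol. -/
  symbol : ∀ t ∈ T, ∀ u ∈ T, t.2.2 = u.2.2 → t = u

/-- A partial transversal is maximal if it is not contained in a partial transversal
of greater length. -/
def IsMaximalPartialTransversal (L : LatinSquare n) (T : Finset (Fin n × Fin n × Fin n)) : Prop :=
  L.IsPartialTransversal T ∧
    ¬ ∃ T' : Finset (Fin n × Fin n × Fin n),
      L.IsPartialTransversal T' ∧ T ⊆ T' ∧ T.card < T'.card

/-- A Latin square of order `n` is omniversal if it has maximal partial transversals of each
length `ℓ` with `⌈n / 2⌉ ≤ ℓ ≤ n`. -/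
def IsOmniversal (L : LatinSquare n) : Prop :=
  ∀ ℓ : ℕ, ⌈(n : ℚ) / 2⌉₊ ≤ ℓ → ℓ ≤ n →
    ∃ T : Finset (Fin n × Fin n × Fin n), L.IsMaximalPartialTransversal T ∧ T.card = ℓ

end LatinSquare

/-!
For the negative part, a maximal partial transversal of length `m` in a square of order `2 * m`
leaves `m` rows and `m` columns in which only its `m` symbols occur, so that the square splits into
four subsquares (`IsMaximalPartialTransversal.exists_blocks`). Counting the cells of a transversal
in the two diagonal subsquares shows that `m` is even (`even_of_blocks`), which excludes the orders
congruent to `2` modulo `4`. In order four the split leaves the cyclic group, which has no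
transversal, and the Klein four-group, in which partial transversals of length three extend. In
order three a partial transversal of length two extends as well.

For the positive part, all lengths come from one exchange (`HasMaximal.of_exchange_le`). Start with
a partial transversal whose unused rows and columns meet in a block `U × V` containing used symbols
only. Replace one of its cells `(r, c)` by a cell of `U × V` with the same symbol and by a cell of
`U` in column `c` and a cell of `V` in row `r` whose symbols are new. No row, column or symbol gets
lost, so that the result is again maximal, and it has two more cells. A family of exchanges with
disjoint rows, columns and new symbols can be carried out in any number. Every construction
provides two such families. One starts from a partial transversal of minimal length `⌈n / 2⌉`, with
`U × V` a subsquare, the other from a partial transversal with one more cell; together they reach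
all lengths.

* In order `4 * h` the square is the Cayley table of `ZMod 2 × ZMod 2 × ZMod h` with one subsquare
  of order two switched (`twistedSquare`). The switch is needed because in the group a parity
  obstruction excludes at least one of the two initial partial transversals.
* In order `4 * h + 1` the square has a subsquare of order `2 * h`, and its other blocks come from
  addition and subtraction in `ZMod (2 * h + 1)` (`subtractionSquare`).
* In order `4 * h + 3` the square has a subsquare of order `2 * h + 1` and consists of midpoints and
  reflections in `ZMod (2 * h + 1)` (`midpointSquare`). Here the two families miss the length `n`,
  but the main diagonal is a transversal.
-/

open Function

/-! ### Maximal partial transversals and exchanges -/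

/-- `HasMaximal f ℓ` says that the array `f`, with rows, columns and symbols in arbitrary types, has
a maximal partial transversal of length `ℓ`. The partial transversal is given by the rows `r i`
and the columns `c i` of its cells; maximality says that every cell in an unused row and an unused
column contains a symbol which is already used. -/
def HasMaximal {R C S : Type} (f : R → C → S) (ℓ : ℕ) : Prop :=
  ∃ (ι : Type) (_ : Fintype ι) (r : ι → R) (c : ι → C), Fintype.card ι = ℓ ∧
    Injective r ∧ Injective c ∧ Injective (fun i => f (r i) (c i)) ∧
    ∀ x y, (∀ i, r i ≠ x) → (∀ i, c i ≠ y) → ∃ i, f (r i) (c i) = f x y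

/-- Relabelling rows, columns and symbols by `Fin n` turns an array into a `LatinSquare n`. -/
theorem LatinSquare.exists_omniversal_of_hasMaximal {R C S : Type} [Fintype R] [Fintype C]
    [Fintype S] {n : ℕ} (hR : Fintype.card R = n) (hC : Fintype.card C = n)
    (hS : Fintype.card S = n) (f : R → C → S) (hrow : ∀ x, Injective (f x))
    (hcol : ∀ y, Injective (fun x => f x y))
    (hf : ∀ ℓ, n ≤ 2 * ℓ → ℓ ≤ n → HasMaximal f ℓ) :
    ∃ L : LatinSquare n, L.IsOmniversal := by
  classical
  let eR := Fintype.equivFinOfCardEq hR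
  let eC := Fintype.equivFinOfCardEq hC
  let eS := Fintype.equivFinOfCardEq hS
  have hrow' : ∀ x, Bijective (f x) := fun x =>
    (Fintype.bijective_iff_injective_and_card _).2 ⟨hrow x, hC.trans hS.symm⟩
  have hcol' : ∀ y, Bijective (fun x => f x y) := fun y =>
    (Fintype.bijective_iff_injective_and_card _).2 ⟨hcol y, hR.trans hS.symm⟩
  let L : LatinSquare n :=
    { entry := fun r c => eS (f (eR.symm r) (eC.symm c))
      row_latin := fun r =>
        (eS.bijective.comp ((hrow' (eR.symm r)).comp eC.symm.bijective)).existsUnique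
      col_latin := fun c =>
        (eS.bijective.comp ((hcol' (eC.symm c)).comp eR.symm.bijective)).existsUnique }
  refine ⟨L, fun ℓ h1 h2 => ?_⟩
  have h3 : n ≤ 2 * ℓ := by
    have := Nat.ceil_le.1 h1
    have h4 : (n : ℚ) ≤ 2 * ℓ := by linarith
    exact_mod_cast h4
  obtain ⟨ι, _, r, c, hι, hr, hc, hs, hmax⟩ := hf ℓ h3 h2
  let F : ι → Fin n × Fin n × Fin n := fun i => (eR (r i), eC (c i), eS (f (r i) (c i)))
  have hF : Injective F := fun i j h => hr (eR.injective (congrArg Prod.fst h))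
  have hmem : ∀ t, t ∈ Finset.univ.image F ↔ ∃ i, F i = t := by simp
  refine ⟨Finset.univ.image F, ⟨⟨?_, ?_, ?_, ?_⟩, ?_⟩, ?_⟩
  · intro t ht
    obtain ⟨i, rfl⟩ := (hmem t).1 ht
    simp [LatinSquare.triples, L, F]
  · intro t ht u hu h
    obtain ⟨i, rfl⟩ := (hmem t).1 ht
    obtain ⟨j, rfl⟩ := (hmem u).1 hu
    rw [hr (eR.injective h)]
  · intro t ht u hu h
    obtain ⟨i, rfl⟩ := (hmem t).1 ht
    obtain ⟨j, rfl⟩ := (hmem u).1 hu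
    rw [hc (eC.injective h)]
  · intro t ht u hu h
    obtain ⟨i, rfl⟩ := (hmem t).1 ht
    obtain ⟨j, rfl⟩ := (hmem u).1 hu
    rw [hs (eS.injective h)]
  · rintro ⟨T', hT', hsub, hcard⟩
    obtain ⟨t, ht, htn⟩ := Finset.exists_mem_notMem_of_card_lt_card hcard
    have key : ∀ i, F i ≠ t := fun i h => htn ((hmem t).2 ⟨i, h⟩)
    have hFT : ∀ i, F i ∈ T' := fun i => hsub ((hmem _).2 ⟨i, rfl⟩)
    obtain ⟨i, hi⟩ := hmax (eR.symm t.1) (eC.symm t.2.1)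
      (fun i h => key i (hT'.row _ (hFT i) _ ht (by simp [F, h])))
      (fun i h => key i (hT'.col _ (hFT i) _ ht (by simp [F, h])))
    refine key i (hT'.symbol _ (hFT i) _ ht ?_)
    have : L.entry t.1 t.2.1 = t.2.2 := hT'.subset t ht
    simp only [F, hi]
    exact this
  · rw [Finset.card_image_of_injective _ hF, Finset.card_univ, hι]

/-- The exchange that lengthens a maximal partial transversal by two cells for each `g : G`:
the cell `(r (e g), c (e g))` gives way to the three cells `(ρ g, κ g)`, which has the same symbol,
`(u g, c (e g))` and `(r (e g), v g)`. All rows, columns and symbols in use stay in use, which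
preserves maximality. -/
theorem HasMaximal.of_exchange {R C S τ G : Type} [Fintype τ] [Fintype G]
    (f : R → C → S) (r : τ → R) (c : τ → C) (e : G → τ) (ρ u : G → R) (κ v : G → C)
    (he : Injective e)
    (hr : Injective (Sum.elim r (Sum.elim ρ u)))
    (hc : Injective (Sum.elim c (Sum.elim κ v)))
    (hs : Injective (Sum.elim (fun t => f (r t) (c t))
      (Sum.elim (fun g => f (u g) (c (e g))) (fun g => f (r (e g)) (v g)))))
    (hA : ∀ g, f (ρ g) (κ g) = f (r (e g)) (c (e g)))
    (hmax : ∀ x y, (∀ t, r t ≠ x) → (∀ t, c t ≠ y) → ∃ t, f (r t) (c t) = f x y) :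
    HasMaximal f (Fintype.card τ + 2 * Fintype.card G) := by
  classical
  -- The new columns and symbols are the old and new ones together, permuted by `φ` and `ψ`.
  let φ : τ ⊕ (G ⊕ G) → τ ⊕ (G ⊕ G) := Sum.elim
    (fun t => if h : ∃ g, e g = t then .inr (.inr h.choose) else .inl t)
    (Sum.elim (fun g => .inr (.inl g)) (fun g => .inl (e g)))
  let ψ : τ ⊕ (G ⊕ G) → τ ⊕ (G ⊕ G) := Sum.elim
    (fun t => if h : ∃ g, e g = t then .inr (.inr h.choose) else .inl t)
    (Sum.elim (fun g => .inl (e g)) (fun g => .inr (.inl g)))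
  have hch : ∀ (t : τ) (h : ∃ g, e g = t), e h.choose = t := fun t h => h.choose_spec
  have hφ : Injective φ := by
    rintro (t | g | g) (t' | g' | g') h <;> simp only [φ, Sum.elim_inl, Sum.elim_inr] at h <;>
      (try split_ifs at h) <;> simp at h <;> grind
  have hψ : Injective ψ := by
    rintro (t | g | g) (t' | g' | g') h <;> simp only [ψ, Sum.elim_inl, Sum.elim_inr] at h <;>
      (try split_ifs at h) <;> simp at h <;> grind
  let r' := Sum.elim r (Sum.elim ρ u)
  let c' := Sum.elim c (Sum.elim κ v) ∘ φ
  let s' := Sum.elim (fun t => f (r t) (c t))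
      (Sum.elim (fun g => f (u g) (c (e g))) (fun g => f (r (e g)) (v g))) ∘ ψ
  have hs' : ∀ i, f (r' i) (c' i) = s' i := by
    rintro (t | g | g)
    · by_cases h : ∃ g, e g = t
      · simp [r', c', s', φ, ψ, h, hch]
      · simp [r', c', s', φ, ψ, h]
    · simp [r', c', s', φ, ψ, hA]
    · simp [r', c', s', φ, ψ]
  refine ⟨τ ⊕ (G ⊕ G), inferInstance, r', c', by simp; ring, hr, hc.comp hφ, ?_, ?_⟩
  · simp only [hs']
    exact hs.comp hψ
  · intro x y hx hy
    obtain ⟨t, ht⟩ := hmax x y (fun t => hx (.inl t)) fun t h => by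
      by_cases h' : ∃ g, e g = t
      · obtain ⟨g, rfl⟩ := h'
        exact hy (.inr (.inr g)) (by simpa [c', φ] using h)
      · exact hy (.inl t) (by simpa [c', φ, h'] using h)
    by_cases h' : ∃ g, e g = t
    · obtain ⟨g, rfl⟩ := h'
      exact ⟨.inr (.inl g), by rw [hs']; simpa [s', ψ] using ht⟩
    · exact ⟨.inl t, by rw [hs']; simpa [s', ψ, h'] using ht⟩

/-- Carrying out the exchange of `HasMaximal.of_exchange` for any number of the indices in `G`.
The symbols `s`, `w` and `w'` of the cells in play are explicit. -/
theorem HasMaximal.of_exchange_le {R C S τ G : Type} [Fintype τ] [Fintype G]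
    {f : R → C → S} (r : τ → R) (c : τ → C) (s : τ → S) (e : G → τ)
    (ρ u : G → R) (κ v : G → C) (w w' : G → S)
    (he : Injective e)
    (hr : Injective (Sum.elim r (Sum.elim ρ u)))
    (hc : Injective (Sum.elim c (Sum.elim κ v)))
    (hs : Injective (Sum.elim s (Sum.elim w w')))
    (hD : ∀ t, f (r t) (c t) = s t) (hA : ∀ g, f (ρ g) (κ g) = s (e g))
    (hB : ∀ g, f (u g) (c (e g)) = w g) (hC : ∀ g, f (r (e g)) (v g) = w' g)
    (hmax : ∀ x y, (∀ t, r t ≠ x) → (∀ t, c t ≠ y) → ∃ t, s t = f x y)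
    {a : ℕ} (ha : a ≤ Fintype.card G) :
    HasMaximal f (Fintype.card τ + 2 * a) := by
  classical
  obtain ⟨J, -, hJ⟩ := Finset.exists_subset_card_eq (s := (Finset.univ : Finset G)) (n := a)
    (by simpa using ha)
  let i : J → G := Subtype.val
  have hi : Injective i := Subtype.val_injective
  have hm : Injective (Sum.map (id : τ → τ) (Sum.map i i)) :=
    injective_id.sumMap (hi.sumMap hi)
  have hcomp : ∀ {X : Type} (p : τ → X) (q q' : G → X),
      Injective (Sum.elim p (Sum.elim q q')) →
      Injective (Sum.elim p (Sum.elim (q ∘ i) (q' ∘ i))) := by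
    intro X p q q' h
    have := h.comp hm
    simpa only [Sum.elim_comp_map, Function.comp_id] using this
  have := HasMaximal.of_exchange f r c (e ∘ i) (ρ ∘ i) (u ∘ i) (κ ∘ i) (v ∘ i) (he.comp hi)
    (hcomp _ _ _ hr) (hcomp _ _ _ hc)
    (by simp only [comp_apply, hD, hB, hC]; exact hcomp _ _ _ hs)
    (fun g => by simp only [comp_apply, hD, hA]) (by simpa only [hD] using hmax)
  rwa [Fintype.card_coe, hJ] at this

/-! ### Orders divisible by four -/

/-- A Latin square of order `4 * h`, built on `ZMod 2 × ZMod h` as a two-fold extension: the Cayley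
table of `ZMod 2 × ZMod 2 × ZMod h` in which the second coordinate is twisted by `χ`. It is Latin
for every `χ`. -/
def twistedSquare {h : ℕ} (χ : ZMod 2 × ZMod h → ZMod 2 × ZMod h → ZMod 2)
    (x y : ZMod 2 × ZMod 2 × ZMod h) : ZMod 2 × ZMod 2 × ZMod h :=
  (x.1 + y.1, x.2.1 + y.2.1 + χ (x.1, x.2.2) (y.1, y.2.2), x.2.2 + y.2.2)

theorem twistedSquare_injective_right {h : ℕ} (χ : ZMod 2 × ZMod h → ZMod 2 × ZMod h → ZMod 2)
    (x : ZMod 2 × ZMod 2 × ZMod h) : Injective (twistedSquare χ x) := by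
  rintro ⟨a, b, i⟩ ⟨a', b', i'⟩ hh
  simp only [twistedSquare, Prod.mk.injEq, add_right_inj] at hh
  obtain ⟨rfl, h2, rfl⟩ := hh
  simpa using h2

theorem twistedSquare_injective_left {h : ℕ} (χ : ZMod 2 × ZMod h → ZMod 2 × ZMod h → ZMod 2)
    (y : ZMod 2 × ZMod 2 × ZMod h) : Injective (fun x => twistedSquare χ x y) := by
  rintro ⟨a, b, i⟩ ⟨a', b', i'⟩ hh
  simp only [twistedSquare, Prod.mk.injEq, add_left_inj] at hh
  obtain ⟨rfl, h2, rfl⟩ := hh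
  simpa using h2

/-- The function `χ` that is `1` at the single cell `(p, q)`. -/
def singleCell {H : Type} [DecidableEq H] (p q : H) (x y : H) : ZMod 2 :=
  if x = p ∧ y = q then 1 else 0

theorem ZMod.two_eq_or (a b : ZMod 2) : a = b ∨ a = 1 + b := by
  revert a b; decide

theorem ZMod.neg_two_ne_zero {h : ℕ} (h3 : 3 ≤ h) : (-2 : ZMod h) ≠ 0 := by
  intro hh
  have : ((2 : ℕ) : ZMod h) = 0 := by
    push_cast
    linear_combination -hh
  rw [ZMod.natCast_eq_zero_iff] at this
  have := Nat.le_of_dvd (by norm_num) this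
  omega

theorem ZMod.two_mul_injective {h : ℕ} (hodd : Odd h) {k l : ZMod h} (hkl : 2 * k = 2 * l) :
    k = l := by
  have hu : IsUnit ((2 : ℕ) : ZMod h) :=
    (ZMod.isUnit_iff_coprime 2 h).2 (Nat.coprime_two_left.2 hodd)
  exact hu.mul_left_cancel (by simpa using hkl)

/-- The parity of the standard representative alternates along the odd cycle `ZMod h`, except from
`-1` to `0`. -/
theorem exists_alternating (h : ℕ) [NeZero h] (hodd : Odd h) :
    ∃ ε : ZMod h → ZMod 2, ε 0 = 0 ∧ ε (-1) = 0 ∧ ∀ k, k ≠ -1 → ε (k + 1) = 1 + ε k := by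
  obtain ⟨m, rfl⟩ := hodd
  refine ⟨fun k => (k.val : ZMod 2), by simp, ?_, ?_⟩
  · have : (-1 : ZMod (2 * m + 1)).val = 2 * m := ZMod.val_neg_one _
    simp only [this]
    push_cast
    have : (2 : ZMod 2) = 0 := by decide
    simp [this]
  · intro k hk
    have : k.val + 1 < 2 * m + 1 := by
      have h1 := ZMod.val_lt k
      by_contra h2
      apply hk
      apply ZMod.val_injective
      have : (-1 : ZMod (2 * m + 1)).val = 2 * m := ZMod.val_neg_one _
      omega
    have h3 : (k + 1).val = k.val + 1 := by
      conv_lhs => rw [← ZMod.natCast_zmod_val k]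
      rw [← Nat.cast_add_one, ZMod.val_natCast_of_lt this]
    simp only [h3]
    push_cast
    ring

/-- The unused rows and columns are those with first coordinate `0`. The switched cell makes up for
the failure of `ε` to alternate at `-1`, which is unavoidable on a cycle of odd length. -/
theorem hasMaximal_twistedSquare_of_odd {h : ℕ} [NeZero h] (hodd : Odd h) (h3 : 3 ≤ h) {a : ℕ}
    (ha : a ≤ h) :
    HasMaximal (twistedSquare (h := h) (singleCell (1, -2) (1, 0))) (2 * h + 2 * a) := by
  obtain ⟨ε, ε0, ε1, hε⟩ := exists_alternating h hodd
  have two_inj : ∀ k l : ZMod h, 2 * k = 2 * l → k = l := fun _ _ => ZMod.two_mul_injective hodd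
  have two_inj' : ∀ k l : ZMod h, 2 * k + 1 = 2 * l - 1 → l = k + 1 := fun k l hkl =>
    two_inj _ _ (by linear_combination -hkl)
  have h2 : (-2 : ZMod h) ≠ 0 := ZMod.neg_two_ne_zero h3
  have key := HasMaximal.of_exchange_le (f := twistedSquare (h := h) (singleCell (1, -2) (1, 0)))
    (τ := ZMod h ⊕ ZMod h) (G := ZMod h)
    (Sum.elim (fun k => (1, 0, k)) (fun k => (1, 1, k - 1)))
    (Sum.elim (fun k => (1, ε k, k)) (fun k => (1, 1 + ε (k + 1), k + 1)))
    (Sum.elim (fun k => (0, ε k, 2 * k)) (fun k => (0, 1 + ε k, 2 * k)))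
    Sum.inr
    (fun k => (0, 0, k)) (fun k => (0, 1, k)) (fun k => (0, 1 + ε k, k)) (fun k => (0, ε k, k))
    (fun k => (1, ε (k + 1), 2 * k + 1)) (fun k => (1, 1 + ε k, 2 * k - 1))
    Sum.inr_injective ?_ ?_ ?_ ?_ ?_ ?_ ?_ ?_ (a := a) (by simpa using ha)
  · simpa [two_mul] using key
  · rintro ((k | k) | (k | k)) ((l | l) | (l | l)) hh <;> simp at hh ⊢ <;> assumption
  · rintro ((k | k) | (k | k)) ((l | l) | (l | l)) hh <;> simp at hh ⊢ <;> grind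
  · rintro ((k | k) | (k | k)) ((l | l) | (l | l)) hh <;> simp at hh ⊢ <;> grind
  · rintro (k | k)
    · simp [twistedSquare, singleCell]; grind
    · by_cases hk : k = -1
      · subst hk
        simp [twistedSquare, singleCell, ε0, ε1]; grind
      · have : k - 1 ≠ -2 := by grind
        simp [twistedSquare, singleCell, this, hε k hk]; grind
  · intro k
    simp [twistedSquare, singleCell]; grind
  · intro k
    simp [twistedSquare, singleCell]; grind
  · intro k
    simp [twistedSquare, singleCell]; grind
  · rintro ⟨a, b, i⟩ ⟨a', b', i'⟩ hx hy
    have ha : a = 0 := by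
      rcases ZMod.two_eq_or a 0 with rfl | rfl
      · rfl
      rcases ZMod.two_eq_or b 0 with rfl | rfl
      · exact absurd rfl (hx (.inl i))
      · exact absurd (by simp) (hx (.inr (i + 1)))
    have ha' : a' = 0 := by
      rcases ZMod.two_eq_or a' 0 with rfl | rfl
      · rfl
      rcases ZMod.two_eq_or b' (ε i') with rfl | rfl
      · exact absurd rfl (hy (.inl i'))
      · exact absurd (by simp) (hy (.inr (i' - 1)))
    subst ha ha'
    obtain ⟨k, hk⟩ := Finite.surjective_of_injective (f := fun k : ZMod h => 2 * k)
      (fun k l hkl => two_inj k l hkl) (i + i')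
    rcases ZMod.two_eq_or (b + b') (ε k) with hb | hb
    · exact ⟨.inl k, by simpa [twistedSquare, singleCell, hb] using hk⟩
    · exact ⟨.inr k, by simpa [twistedSquare, singleCell, hb] using hk⟩

/-- The unused rows and columns are those with second coordinate `0`, except for the row
`(1, 0, -2)` and the column `(1, 0, 0)` of one switched cell. Outside this row the switch does not
affect them, so that they meet in symbols with second coordinate `0`. -/
theorem hasMaximal_twistedSquare_of_odd' {h : ℕ} [NeZero h] (hodd : Odd h) (h3 : 3 ≤ h) {a : ℕ}
    (ha : a ≤ h - 1) :
    HasMaximal (twistedSquare (h := h) (singleCell (1, -2) (1, 0))) (2 * h + 1 + 2 * a) := by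
  obtain ⟨ε, ε0, ε1, hε⟩ := exists_alternating h hodd
  have two_inj : ∀ k l : ZMod h, 2 * k = 2 * l → k = l := fun _ _ => ZMod.two_mul_injective hodd
  have two_inj' : ∀ k : ZMod h, 2 * k = -2 → k = -1 := fun k hk =>
    two_inj _ _ (by linear_combination hk)
  have h2 : (-2 : ZMod h) ≠ 0 := ZMod.neg_two_ne_zero h3
  have key := HasMaximal.of_exchange_le (f := twistedSquare (h := h) (singleCell (1, -2) (1, 0)))
    (τ := (ZMod h ⊕ {k : ZMod h // k ≠ -1}) ⊕ (Unit ⊕ Unit)) (G := {k : ZMod h // k ≠ -1})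
    (Sum.elim (Sum.elim (fun k => (1, 1, k)) (fun k => (0, 1, k - 1)))
      (Sum.elim (fun _ => (1, 0, -2)) (fun _ => (0, 1, -2))))
    (Sum.elim (Sum.elim (fun k => (ε k, 1, k)) (fun k => (1 + ε (k + 1), 1, k + 1)))
      (Sum.elim (fun _ => (1, 1, 0)) (fun _ => (1, 0, 0))))
    (Sum.elim (Sum.elim (fun k => (1 + ε k, 0, 2 * k)) (fun k => (ε k, 0, 2 * k)))
      (Sum.elim (fun _ => (0, 0, -2)) (fun _ => (1, 1, -2))))
    (fun k => .inl (.inr k))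
    (fun k => (0, 0, k)) (fun k => (1, 0, k - 1)) (fun k => (ε k, 0, k))
    (fun k => (1 + ε (k + 1), 0, k + 1))
    (fun k => (ε (k + 1), 1, 2 * k)) (fun k => (1 + ε (k + 1), 1, 2 * k))
    (fun k l hkl => by simpa using hkl)
    ?_ ?_ ?_ ?_ ?_ ?_ ?_ ?_ (a := a) (by simpa [Fintype.card_subtype_compl] using ha)
  · have hc : Fintype.card ((ZMod h ⊕ {k : ZMod h // k ≠ -1}) ⊕ (Unit ⊕ Unit)) = 2 * h + 1 := by
      simp [Fintype.card_subtype_compl]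
      omega
    rwa [hc] at key
  · rintro (((k | ⟨k, hk⟩) | (k | k)) | (⟨k, hk⟩ | ⟨k, hk⟩))
      (((l | ⟨l, hl⟩) | (l | l)) | (⟨l, hl⟩ | ⟨l, hl⟩)) hh <;> simp at hh ⊢ <;> grind
  · rintro (((k | ⟨k, hk⟩) | (k | k)) | (⟨k, hk⟩ | ⟨k, hk⟩))
      (((l | ⟨l, hl⟩) | (l | l)) | (⟨l, hl⟩ | ⟨l, hl⟩)) hh <;> simp at hh ⊢ <;> grind
  · rintro (((k | ⟨k, hk⟩) | (k | k)) | (⟨k, hk⟩ | ⟨k, hk⟩))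
      (((l | ⟨l, hl⟩) | (l | l)) | (⟨l, hl⟩ | ⟨l, hl⟩)) hh <;> simp at hh ⊢ <;> grind
  · rintro ((k | ⟨k, hk⟩) | (k | k)) <;> simp [twistedSquare, singleCell] <;> grind
  · rintro ⟨k, hk⟩
    simp [twistedSquare, singleCell]; grind
  · rintro ⟨k, hk⟩
    simp [twistedSquare, singleCell]; grind
  · rintro ⟨k, hk⟩
    simp [twistedSquare, singleCell]; grind
  · rintro ⟨a, b, i⟩ ⟨a', b', i'⟩ hx hy
    have hb : b = 0 := by
      rcases ZMod.two_eq_or b 0 with rfl | rfl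
      · rfl
      rcases ZMod.two_eq_or a 0 with rfl | rfl
      · by_cases hi : i = -2
        · subst hi
          exact absurd rfl (hx (.inr (.inr ())))
        · exact absurd (by simp) (hx (.inl (.inr ⟨i + 1, by grind⟩)))
      · exact absurd rfl (hx (.inl (.inl i)))
    have hb' : b' = 0 := by
      rcases ZMod.two_eq_or b' 0 with rfl | rfl
      · rfl
      rcases ZMod.two_eq_or a' (ε i') with rfl | rfl
      · exact absurd rfl (hy (.inl (.inl i')))
      · by_cases hi : i' = 0
        · subst hi
          exact absurd (by simp [ε0]) (hy (.inr (.inl ())))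
        · exact absurd (by simp) (hy (.inl (.inr ⟨i' - 1, by grind⟩)))
    subst hb hb'
    have hai : ¬ (a = 1 ∧ i = -2) := by
      rintro ⟨rfl, rfl⟩
      exact hx (.inr (.inl ())) rfl
    obtain ⟨k, hk⟩ := Finite.surjective_of_injective (f := fun k : ZMod h => 2 * k)
      (fun k l hkl => two_inj k l hkl) (i + i')
    have hf : twistedSquare (singleCell (1, -2) (1, 0)) (a, 0, i) (a', 0, i') =
        (a + a', 0, 2 * k) := by
      simp [twistedSquare, singleCell, hai]
      exact hk.symm
    rw [hf]
    rcases ZMod.two_eq_or (a + a') (ε k) with hb | hb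
    · by_cases hk1 : k = -1
      · exact ⟨.inr (.inl ()), by simp [hb, hk1, ε1]⟩
      · exact ⟨.inl (.inr ⟨k, hk1⟩), by simp [hb]⟩
    · exact ⟨.inl (.inl k), by simp [hb]⟩

/-- The indicator of the larger half of the standard representatives separates the two solutions `k`
of an equation `2 * k = d`. -/
theorem exists_halving (h : ℕ) [NeZero h] (heven : Even h) :
    ∃ ε : ZMod h → ZMod 2, ε 0 = 0 ∧ ∀ i j, 2 * i = 2 * j → ε i = ε j → i = j := by
  obtain ⟨g, rfl⟩ := heven
  have hg : 0 < g := by have := NeZero.ne (g + g); omega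
  refine ⟨fun k => if g ≤ k.val then 1 else 0, by simp [hg.ne'], fun i j hij he => ?_⟩
  have hi := ZMod.val_lt i
  have hj := ZMod.val_lt j
  have h1 : ((2 * i.val : ℕ) : ZMod (g + g)) = ((2 * j.val : ℕ) : ZMod (g + g)) := by
    push_cast
    rwa [ZMod.natCast_zmod_val, ZMod.natCast_zmod_val]
  rw [ZMod.natCast_eq_natCast_iff] at h1
  have h1' : 2 * i.val ≡ 2 * j.val [MOD 2 * g] := by rwa [two_mul g]
  have h2 : i.val ≡ j.val [MOD g] := Nat.ModEq.mul_left_cancel' two_ne_zero h1'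
  apply ZMod.val_injective
  have split : ∀ k : ZMod (g + g), k.val % g = if g ≤ k.val then k.val - g else k.val := by
    intro k
    have hk := ZMod.val_lt k
    split_ifs with h
    · rw [Nat.mod_eq_sub_mod h, Nat.mod_eq_of_lt (by omega)]
    · exact Nat.mod_eq_of_lt (by omega)
  have h3 : i.val % g = j.val % g := h2
  rw [split, split] at h3
  have h01 : (1 : ZMod 2) ≠ 0 := by decide
  have h10 : (0 : ZMod 2) ≠ 1 := by decide
  dsimp only at he
  split_ifs at h3 he <;> first | omega | exact absurd he h01 | exact absurd he h10

theorem two_mul_add_one_ne_two_mul {h : ℕ} (heven : Even h) (i j : ZMod h) :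
    2 * i + 1 ≠ 2 * j := by
  intro hij
  have := congrArg (ZMod.castHom heven.two_dvd (ZMod 2)) hij
  simp only [map_add, map_mul, map_one, map_ofNat] at this
  have h2 : (2 : ZMod 2) = 0 := by decide
  rw [h2, zero_mul, zero_mul] at this
  exact absurd this (by decide)

/-- The unused rows and columns are those with first coordinate `0`. No cell used here is
switched. -/
theorem hasMaximal_twistedSquare_of_even {h : ℕ} [NeZero h] (heven : Even h) {a : ℕ} (ha : a ≤ h) :
    HasMaximal (twistedSquare (h := h) (singleCell (0, 0) (1, 0))) (2 * h + 2 * a) := by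
  obtain ⟨ε, ε0, hε⟩ := exists_halving h heven
  have hpar := two_mul_add_one_ne_two_mul heven
  have h1 : (-1 : ZMod h) ≠ 0 := fun hh => hpar 0 0 (by linear_combination -hh)
  have hw : ∀ i j : ZMod h, 2 * i - 1 ≠ 2 * j := fun i j hh =>
    hpar j i (by linear_combination -hh)
  have hsinj : Injective (Sum.elim (fun k => (ε k, 2 * k)) (fun k => (ε k, 2 * k + 1)) :
      ZMod h ⊕ ZMod h → ZMod 2 × ZMod h) := by
    rintro (k | k) (l | l) hh <;> simp at hh ⊢ <;> grind
  have hsurj := ((Fintype.bijective_iff_injective_and_card _).2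
    ⟨hsinj, by simp [ZMod.card, two_mul]⟩).surjective
  have key := HasMaximal.of_exchange_le (f := twistedSquare (h := h) (singleCell (0, 0) (1, 0)))
    (τ := ZMod h ⊕ ZMod h) (G := ZMod h)
    (Sum.elim (fun k => (1, 0, k)) (fun k => (1, 1, k + 1)))
    (Sum.elim (fun k => (1, ε k, k)) (fun k => (1, 1 + ε k, k)))
    (Sum.elim (fun k => (0, ε k, 2 * k)) (fun k => (0, ε k, 2 * k + 1)))
    Sum.inl
    (fun k => (0, 0, k)) (fun k => (0, 1, k - 1)) (fun k => (0, ε k, k)) (fun k => (0, 1 + ε k, k))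
    (fun k => (1, 1 + ε k, 2 * k - 1)) (fun k => (1, 1 + ε k, 2 * k))
    Sum.inl_injective ?_ ?_ ?_ ?_ ?_ ?_ ?_ ?_ (a := a) (by simpa using ha)
  · simpa [two_mul] using key
  · rintro ((k | k) | (k | k)) ((l | l) | (l | l)) hh <;> simp at hh ⊢ <;> assumption
  · rintro ((k | k) | (k | k)) ((l | l) | (l | l)) hh <;> simp at hh ⊢ <;> grind
  · rintro ((k | k) | (k | k)) ((l | l) | (l | l)) hh <;> simp at hh ⊢ <;> grind
  · rintro (k | k) <;> simp [twistedSquare, singleCell] <;> grind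
  · intro k
    simp [twistedSquare, singleCell]; grind
  · intro k
    have : ¬ (k - 1 = 0 ∧ k = 0) := by grind
    simp [twistedSquare, singleCell, this]; grind
  · intro k
    simp [twistedSquare, singleCell]; grind
  · rintro ⟨a, b, i⟩ ⟨a', b', i'⟩ hx hy
    have ha : a = 0 := by
      rcases ZMod.two_eq_or a 0 with rfl | rfl
      · rfl
      rcases ZMod.two_eq_or b 0 with rfl | rfl
      · exact absurd rfl (hx (.inl i))
      · exact absurd (by simp) (hx (.inr (i - 1)))
    have ha' : a' = 0 := by
      rcases ZMod.two_eq_or a' 0 with rfl | rfl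
      · rfl
      rcases ZMod.two_eq_or b' (ε i') with rfl | rfl
      · exact absurd rfl (hy (.inl i'))
      · exact absurd rfl (hy (.inr i'))
    subst ha ha'
    obtain ⟨k | k, hk⟩ := hsurj (b + b', i + i')
    · exact ⟨.inl k, by simpa [twistedSquare, singleCell] using hk⟩
    · exact ⟨.inr k, by simpa [twistedSquare, singleCell] using hk⟩

/-- The unused rows and columns are those with second coordinate `0`, except for the row `(0, 0, 0)`
and the column `(1, 0, 0)` of one switched cell, which is used. Its symbol `(1, 1, 0)` is the only
one with second coordinate `1` among the initial symbols. -/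
theorem hasMaximal_twistedSquare_of_even' {h : ℕ} [NeZero h] (heven : Even h) {a : ℕ}
    (ha : a ≤ h - 1) :
    HasMaximal (twistedSquare (h := h) (singleCell (0, 0) (1, 0))) (2 * h + 1 + 2 * a) := by
  obtain ⟨ε, ε0, hε⟩ := exists_halving h heven
  have hpar := two_mul_add_one_ne_two_mul heven
  have hw : ∀ i j : ZMod h, 2 * i - 1 ≠ 2 * j := fun i j hh =>
    hpar j i (by linear_combination -hh)
  have hw0 : ∀ j : ZMod h, 2 * j - 1 ≠ 0 := fun j hh => hpar 0 j (by linear_combination -hh)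
  have hsinj : Injective (Sum.elim (fun k => (ε k, 2 * k)) (fun k => (ε k, 2 * k + 1)) :
      ZMod h ⊕ ZMod h → ZMod 2 × ZMod h) := by
    rintro (k | k) (l | l) hh <;> simp at hh ⊢ <;> grind
  have hsurj := ((Fintype.bijective_iff_injective_and_card _).2
    ⟨hsinj, by simp [ZMod.card, two_mul]⟩).surjective
  have key := HasMaximal.of_exchange_le (f := twistedSquare (h := h) (singleCell (0, 0) (1, 0)))
    (τ := (ZMod h ⊕ ZMod h) ⊕ Unit) (G := {k : ZMod h // k ≠ 0})
    (Sum.elim (Sum.elim (fun k => (0, 1, k)) (fun k => (1, 1, k + 1))) (fun _ => (0, 0, 0)))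
    (Sum.elim (Sum.elim (fun k => (ε k, 1, k)) (fun k => (1 + ε k, 1, k))) (fun _ => (1, 0, 0)))
    (Sum.elim (Sum.elim (fun k => (ε k, 0, 2 * k)) (fun k => (ε k, 0, 2 * k + 1)))
      (fun _ => (1, 1, 0)))
    (fun k => .inl (.inl k))
    (fun k => (0, 0, k)) (fun k => (1, 0, k - 1)) (fun k => (ε k, 0, k)) (fun k => (1 + ε k, 0, k))
    (fun k => (1 + ε k, 1, 2 * k - 1)) (fun k => (1 + ε k, 1, 2 * k))
    (fun k l hkl => by simpa [Subtype.ext_iff] using hkl)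
    ?_ ?_ ?_ ?_ ?_ ?_ ?_ ?_ (a := a) (by simpa [Fintype.card_subtype_compl] using ha)
  · have hc : Fintype.card ((ZMod h ⊕ ZMod h) ⊕ Unit) = 2 * h + 1 := by
      simp [two_mul]
    rwa [hc] at key
  · rintro (((k | k) | k) | (⟨k, hk⟩ | ⟨k, hk⟩))
      (((l | l) | l) | (⟨l, hl⟩ | ⟨l, hl⟩)) hh <;> simp at hh ⊢ <;> grind
  · rintro (((k | k) | k) | (⟨k, hk⟩ | ⟨k, hk⟩))
      (((l | l) | l) | (⟨l, hl⟩ | ⟨l, hl⟩)) hh <;> simp at hh ⊢ <;> grind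
  · rintro (((k | k) | k) | (⟨k, hk⟩ | ⟨k, hk⟩))
      (((l | l) | l) | (⟨l, hl⟩ | ⟨l, hl⟩)) hh <;> simp at hh ⊢ <;> grind
  · rintro ((k | k) | k) <;> simp [twistedSquare, singleCell] <;> grind
  · rintro ⟨k, hk⟩
    simp [twistedSquare, singleCell, hk]; grind
  · rintro ⟨k, hk⟩
    simp [twistedSquare, singleCell]; grind
  · rintro ⟨k, hk⟩
    simp [twistedSquare, singleCell, hk]; grind
  · rintro ⟨a, b, i⟩ ⟨a', b', i'⟩ hx hy
    have hb : b = 0 := by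
      rcases ZMod.two_eq_or b 0 with rfl | rfl
      · rfl
      rcases ZMod.two_eq_or a 0 with rfl | rfl
      · exact absurd rfl (hx (.inl (.inl i)))
      · exact absurd (by simp) (hx (.inl (.inr (i - 1))))
    have hb' : b' = 0 := by
      rcases ZMod.two_eq_or b' 0 with rfl | rfl
      · rfl
      rcases ZMod.two_eq_or a' (ε i') with rfl | rfl
      · exact absurd rfl (hy (.inl (.inl i')))
      · exact absurd rfl (hy (.inl (.inr i')))
    subst hb hb'
    have hai : ¬ (a = 0 ∧ i = 0) := by
      rintro ⟨rfl, rfl⟩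
      exact hx (.inr ()) rfl
    obtain ⟨k | k, hk⟩ := hsurj (a + a', i + i')
    · exact ⟨.inl (.inl k), by simpa [twistedSquare, singleCell, hai] using hk⟩
    · exact ⟨.inl (.inr k), by simpa [twistedSquare, singleCell, hai] using hk⟩

theorem LatinSquare.exists_omniversal_four_mul {h : ℕ} (h2 : 2 ≤ h) :
    ∃ L : LatinSquare (4 * h), L.IsOmniversal := by
  have : NeZero h := ⟨by omega⟩
  have hcard : Fintype.card (ZMod 2 × ZMod 2 × ZMod h) = 4 * h := by
    simp [ZMod.card]
    ring
  obtain ⟨χ, hχ, hχ'⟩ : ∃ χ : ZMod 2 × ZMod h → ZMod 2 × ZMod h → ZMod 2,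
      (∀ a ≤ h, HasMaximal (twistedSquare χ) (2 * h + 2 * a)) ∧
      (∀ a ≤ h - 1, HasMaximal (twistedSquare χ) (2 * h + 1 + 2 * a)) := by
    rcases Nat.even_or_odd h with heven | hodd
    · exact ⟨_, fun a => hasMaximal_twistedSquare_of_even heven,
        fun a => hasMaximal_twistedSquare_of_even' heven⟩
    · have h3 : 3 ≤ h := by
        obtain ⟨m, rfl⟩ := hodd
        omega
      exact ⟨_, fun a => hasMaximal_twistedSquare_of_odd hodd h3,
        fun a => hasMaximal_twistedSquare_of_odd' hodd h3⟩
  refine LatinSquare.exists_omniversal_of_hasMaximal hcard hcard hcard (twistedSquare χ)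
    (twistedSquare_injective_right χ) (twistedSquare_injective_left χ) fun ℓ hl hu => ?_
  obtain ⟨a, ha | ha⟩ : ∃ a, ℓ = 2 * h + 2 * a ∨ ℓ = 2 * h + 1 + 2 * a :=
    ⟨(ℓ - 2 * h) / 2, by omega⟩
  · rw [ha]
    exact hχ a (by omega)
  · rw [ha]
    exact hχ' a (by omega)

/-! ### Orders congruent to one modulo four -/

/-- Two injections into finite types of the same size differ by an equivalence. -/
theorem Fintype.exists_equiv_apply_eq {X Y ι : Type} [Fintype X] [Fintype Y]
    (hXY : Fintype.card X = Fintype.card Y) (p : ι → X) (q : ι → Y)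
    (hp : Injective p) (hq : Injective q) : ∃ e : X ≃ Y, ∀ i, e (p i) = q i := by
  classical
  rcases isEmpty_or_nonempty ι with hι | ⟨⟨i₀⟩⟩
  · exact ⟨Fintype.equivOfCardEq hXY, fun i => (hι.false i).elim⟩
  let f : X → Y := extend p q (fun _ => q i₀)
  have hf : ∀ i, f (p i) = q i := fun i => hp.extend_apply _ _ i
  have : Set.MapsTo f (Set.range p) (Finset.univ : Finset Y) := fun _ _ => by simp
  obtain ⟨g, hg⟩ := this.exists_equiv_extend_of_card_eq (by simpa using hXY) (by
    rintro _ ⟨i, rfl⟩ _ ⟨j, rfl⟩ hij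
    rw [hf, hf] at hij
    rw [hq hij])
  refine ⟨g.trans (Equiv.subtypeUnivEquiv (by simp)), fun i => ?_⟩
  have := hg (p i) ⟨i, rfl⟩
  simpa [hf] using this

theorem ZMod.natCast_inj_of_lt {n a b : ℕ} (ha : a < n) (hb : b < n)
    (h : (a : ZMod n) = b) : a = b := by
  rw [ZMod.natCast_eq_natCast_iff] at h
  exact h.eq_of_lt_of_lt ha hb

/-- A partial transversal of length at most about half the order can be prescribed. It is taken
along the main diagonal of a cyclic square, whose first entries `0, 2, 4, …` are distinct. -/
theorem exists_latin_of_injective {R C S : Type} [Fintype R] [Fintype C] [Fintype S] {m h : ℕ}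
    (hh : 2 * h ≤ m + 1) (hR : Fintype.card R = m) (hC : Fintype.card C = m)
    (hS : Fintype.card S = m) (ρ : Fin h → R) (κ : Fin h → C) (σ : Fin h → S)
    (hρ : Injective ρ) (hκ : Injective κ) (hσ : Injective σ) :
    ∃ A : R → C → S, (∀ x, Injective (A x)) ∧ (∀ y, Injective (fun x => A x y)) ∧
      ∀ l, A (ρ l) (κ l) = σ l := by
  rcases Nat.eq_zero_or_pos m with rfl | hm
  · have := Fintype.card_eq_zero_iff.1 hR
    have := Fintype.card_eq_zero_iff.1 hC
    exact ⟨fun x => isEmptyElim x, fun x => isEmptyElim x, fun y => isEmptyElim y,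
      fun l => isEmptyElim (ρ l)⟩
  have : NeZero m := ⟨hm.ne'⟩
  have h1 : Injective (fun l : Fin h => ((l.val : ℕ) : ZMod m)) := fun l k hlk =>
    Fin.ext (ZMod.natCast_inj_of_lt (by omega) (by omega) hlk)
  have h2 : Injective (fun l : Fin h => ((2 * l.val : ℕ) : ZMod m)) := fun l k hlk => by
    have := ZMod.natCast_inj_of_lt (by omega) (by omega) hlk
    exact Fin.ext (by omega)
  obtain ⟨e₁, he₁⟩ := Fintype.exists_equiv_apply_eq (hR.trans (ZMod.card m).symm) ρ _ hρ h1
  obtain ⟨e₂, he₂⟩ := Fintype.exists_equiv_apply_eq (hC.trans (ZMod.card m).symm) κ _ hκ h1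
  obtain ⟨e₃, he₃⟩ := Fintype.exists_equiv_apply_eq (hS.trans (ZMod.card m).symm) σ _ hσ h2
  refine ⟨fun x y => e₃.symm (e₁ x + e₂ y), fun x y y' hy => ?_, fun y x x' hx => ?_, fun l => ?_⟩
  · simpa using hy
  · simpa using hx
  · rw [Equiv.symm_apply_eq, he₁, he₂, he₃]
    push_cast
    ring

/-- A square of odd order, whose rows, columns and symbols are the nonzero elements of the additive
group `Z`, followed by all elements of `Z`. It has the subsquare `A`. The lower right block holds the
differences of row and column, except that `x` as a symbol of the second kind replaces the missing
difference `0` in row `x`. -/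
def subtractionSquare {Z : Type} [AddCommGroup Z] [DecidableEq Z]
    (A : {x : Z // x ≠ 0} → {x : Z // x ≠ 0} → {x : Z // x ≠ 0}) :
    {x : Z // x ≠ 0} ⊕ Z → {x : Z // x ≠ 0} ⊕ Z → {x : Z // x ≠ 0} ⊕ Z
  | .inl x, .inl y => .inl (A x y)
  | .inl x, .inr y => .inr (x + y)
  | .inr x, .inl y => .inr (x - y)
  | .inr x, .inr y => if hxy : x = y then .inr x else .inl ⟨x - y, sub_ne_zero.2 hxy⟩

section

variable {Z : Type} [AddCommGroup Z] [DecidableEq Z]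
  {A : {x : Z // x ≠ 0} → {x : Z // x ≠ 0} → {x : Z // x ≠ 0}}

theorem subtractionSquare_injective_right (hA : ∀ x, Injective (A x)) (x : {x : Z // x ≠ 0} ⊕ Z) :
    Injective (subtractionSquare A x) := by
  rcases x with x | x
  · rintro (y | y) (z | z) hyz <;> simp [subtractionSquare] at hyz ⊢
    · exact hA x hyz
    · exact hyz
  · rintro (⟨y, hy⟩ | y) (⟨z, hz⟩ | z) hyz <;> simp only [subtractionSquare] at hyz <;>
      (try split_ifs at hyz) <;>
      simp only [Sum.inl.injEq, Sum.inr.injEq, Subtype.mk.injEq, sub_right_inj, sub_eq_self,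
        eq_comm (a := x) (b := x - _), reduceCtorEq] at hyz ⊢ <;> grind

theorem subtractionSquare_injective_left (hA : ∀ y, Injective (fun x => A x y))
    (y : {x : Z // x ≠ 0} ⊕ Z) : Injective (fun x => subtractionSquare A x y) := by
  rcases y with y | y
  · rintro (x | x) (z | z) hxz <;> simp [subtractionSquare] at hxz ⊢
    · exact hA y hxz
    · exact hxz
  · rintro (⟨x, hx⟩ | x) (⟨z, hz⟩ | z) hxz <;> simp only [subtractionSquare] at hxz <;>
      (try split_ifs at hxz) <;>
      simp only [Sum.inl.injEq, Sum.inr.injEq, Subtype.mk.injEq, sub_left_inj, add_left_inj,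
        reduceCtorEq] at hxz ⊢ <;> grind

end

set_option maxHeartbeats 1000000 in
/-- The exchanged cells are `(a, -a)` for `a = 1, …, h + 1`, where the lower right block holds
`2 * a`. Since the modulus `N` is odd, the elements `2 * a` and `2 * a - 1` exhaust the nonzero
elements, and so do the elements `a` and `-a`. -/
theorem LatinSquare.exists_omniversal_four_mul_add_five (h : ℕ) :
    ∃ L : LatinSquare (4 * h + 5), L.IsOmniversal := by
  obtain ⟨N, hN⟩ : ∃ N, N = 2 * h + 3 := ⟨_, rfl⟩
  have : NeZero N := ⟨by omega⟩
  have two_inj : ∀ k l : ZMod N, 2 * k = 2 * l → k = l := fun _ _ =>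
    ZMod.two_mul_injective ⟨h + 1, by omega⟩
  have hinj : ∀ {a b : ℕ}, a < N → b < N → (a : ZMod N) = b → a = b := ZMod.natCast_inj_of_lt
  let a : Fin (h + 1) → ZMod N := fun l => (l.val + 1 : ℕ)
  have a_inj : ∀ k l, a k = a l → k = l := fun k l hkl => by
    have := hinj (by omega) (by omega) hkl
    exact Fin.ext (by omega)
  have a_zero : a 0 = 1 := by simp [a]
  have a_add : ∀ k l, a k + a l ≠ 0 := fun k l hkl => by
    have := hinj (a := k.val + 1 + (l.val + 1)) (b := 0) (by omega) (by omega)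
      (by simpa [a] using hkl)
    omega
  have a_ne : ∀ k, a k ≠ 0 := fun k hk => a_add k k (by simp [hk])
  have a_odd : ∀ k l, 2 * a k - 1 ≠ 2 * a l := fun k l hkl => by
    have := hinj (a := 2 * k.val + 1) (b := 2 * (l.val + 1)) (by omega) (by omega)
      (by have : 2 * ((k.val + 1 : ℕ) : ZMod N) - 1 = 2 * ((l.val + 1 : ℕ) : ZMod N) := hkl
          push_cast at this ⊢
          linear_combination this)
    omega
  have a_odd_ne : ∀ k, 2 * a k - 1 ≠ 0 := fun k hk => by
    have := hinj (a := 2 * k.val + 1) (b := 0) (by omega) (by omega)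
      (by have : 2 * ((k.val + 1 : ℕ) : ZMod N) - 1 = 0 := hk
          push_cast at this ⊢
          linear_combination this)
    omega
  have a_neg : ∀ k l, a k ≠ -a l := fun k l hkl => a_add k l (by rw [hkl, neg_add_cancel])
  have two_ne : ∀ x : ZMod N, x ≠ 0 → 2 * x ≠ 0 := fun x hx h2 =>
    hx (two_inj x 0 (by simpa using h2))
  have hneg : ∀ x : ZMod N, x = -x → x = 0 := fun x hx => two_inj x 0 (by linear_combination hx)
  have one_ne : (1 : ZMod N) ≠ 0 := a_zero ▸ a_ne 0
  have double_surj : Surjective (fun k : {x : ZMod N // x ≠ 0} =>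
      (⟨2 * k, two_ne _ k.2⟩ : {x : ZMod N // x ≠ 0})) :=
    Finite.surjective_of_injective fun k l hkl =>
      Subtype.ext (two_inj k l (congrArg Subtype.val hkl))
  have a_succ : ∀ l : Fin h, a l.succ ≠ 1 := fun l hl =>
    (Fin.succ_ne_zero l) (a_inj _ _ (hl.trans a_zero.symm))
  have a_succ_neg : ∀ l : Fin h, a l.succ ≠ -1 := fun l hl => a_neg l.succ 0 (by rw [hl, a_zero])
  clear_value a
  let p : Fin (h + 1) → {x : ZMod N // x ≠ 0} := fun l => ⟨2 * a l - 1, a_odd_ne l⟩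
  let q : Fin (h + 1) → {x : ZMod N // x ≠ 0} := fun l => ⟨2 * a l, two_ne _ (a_ne l)⟩
  have hp : Injective p := fun k l hkl => by
    have : 2 * a k - 1 = 2 * a l - 1 := congrArg Subtype.val hkl
    exact a_inj _ _ (two_inj _ _ (by linear_combination this))
  have hq : Injective q := fun k l hkl => a_inj _ _ (two_inj _ _ (congrArg Subtype.val hkl))
  have hcard : Fintype.card {x : ZMod N // x ≠ 0} = 2 * h + 2 := by
    simp [Fintype.card_subtype_compl]
    omega
  -- The prescribed cells of the subsquare are those used in the exchanges.
  obtain ⟨A, hA₁, hA₂, hA⟩ := exists_latin_of_injective (m := 2 * h + 2) (h := h + 1) (by omega)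
    hcard hcard hcard p p q hp hp hq
  have hcard' : Fintype.card ({x : ZMod N // x ≠ 0} ⊕ ZMod N) = 4 * h + 5 := by
    rw [Fintype.card_sum, hcard, ZMod.card]
    omega
  refine LatinSquare.exists_omniversal_of_hasMaximal hcard' hcard' hcard' (subtractionSquare A)
    (subtractionSquare_injective_right hA₁) (subtractionSquare_injective_left hA₂) ?_
  have key₁ : ∀ b ≤ h + 1, HasMaximal (subtractionSquare A) (N + 2 * b) := by
    intro b hb
    -- The unused rows and columns are those of the subsquare.
    have key := HasMaximal.of_exchange_le (f := subtractionSquare A)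
      (τ := {x : ZMod N // x ≠ 0} ⊕ Unit) (G := Fin (h + 1))
      (Sum.elim (fun x => .inr x) (fun _ => .inr 0))
      (Sum.elim (fun x => .inr (-x)) (fun _ => .inr 0))
      (Sum.elim (fun x => .inl ⟨2 * x, two_ne _ x.2⟩) (fun _ => .inr 0))
      (fun l => .inl ⟨a l, a_ne l⟩)
      (fun l => .inl (p l)) (fun l => .inl (q l)) (fun l => .inl (p l)) (fun l => .inl (q l))
      (fun l => .inr (a l)) (fun l => .inr (-a l))
      (fun k l hkl => a_inj k l (by simpa using hkl))
      ?_ ?_ ?_ ?_ ?_ ?_ ?_ ?_ (a := b) (by simpa using hb)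
    · have hc : Fintype.card ({x : ZMod N // x ≠ 0} ⊕ Unit) = N := by
        rw [Fintype.card_sum, hcard, Fintype.card_unit, hN]
      rwa [hc] at key
    · clear hA hA₁ hA₂ hp hq hinj
      rintro ((⟨k, hk⟩ | k) | (k | k)) ((⟨l, hl⟩ | l) | (l | l)) hh <;> simp [p, q] at hh ⊢ <;>
        clear p q <;> grind
    · clear hA hA₁ hA₂ hp hq hinj
      rintro ((⟨k, hk⟩ | k) | (k | k)) ((⟨l, hl⟩ | l) | (l | l)) hh <;> simp [p, q] at hh ⊢ <;>
        clear p q <;> grind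
    · clear hA hA₁ hA₂ hp hq hinj p q
      rintro ((⟨k, hk⟩ | k) | (k | k)) ((⟨l, hl⟩ | l) | (l | l)) hh <;> simp at hh ⊢ <;>
        grind
    · rintro (⟨k, hk⟩ | k)
      · simp [subtractionSquare, mt (hneg k) hk]; ring
      · simp [subtractionSquare]
    · intro l
      simp [hA, q, subtractionSquare]
    · intro l
      simp [subtractionSquare, q]; ring
    · intro l
      simp [subtractionSquare, q]; ring
    · intro x y hx hy
      obtain ⟨x, rfl⟩ : ∃ x', x = .inl x' := by
        rcases x with x | x
        · exact ⟨x, rfl⟩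
        · by_cases h0 : x = 0
          · exact absurd (by simp [h0]) (hx (.inr ()))
          · exact absurd rfl (hx (.inl ⟨x, h0⟩))
      obtain ⟨y, rfl⟩ : ∃ y', y = .inl y' := by
        rcases y with y | y
        · exact ⟨y, rfl⟩
        · by_cases h0 : y = 0
          · exact absurd (by simp [h0]) (hy (.inr ()))
          · exact absurd (by simp) (hy (.inl ⟨-y, by simpa using h0⟩))
      obtain ⟨z, hz⟩ := double_surj (A x y)
      exact ⟨.inl z, congrArg Sum.inl hz⟩
  have key₂ : ∀ b ≤ h, HasMaximal (subtractionSquare A) (N + 1 + 2 * b) := by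
    intro b hb
    -- The cell `(0, 0)` of the lower right block makes way for the two cells in its row and its
    -- column that meet the column `1` and the row `1` of the subsquare.
    have key := HasMaximal.of_exchange_le (f := subtractionSquare A)
      (τ := {x : ZMod N // x ≠ 0} ⊕ (Unit ⊕ Unit)) (G := Fin h)
      (Sum.elim (fun x => .inr x) (Sum.elim (fun _ => .inl ⟨1, one_ne⟩) (fun _ => .inr 0)))
      (Sum.elim (fun x => .inr (-x)) (Sum.elim (fun _ => .inr 0) (fun _ => .inl ⟨1, one_ne⟩)))
      (Sum.elim (fun x => .inl ⟨2 * x, two_ne _ x.2⟩)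
        (Sum.elim (fun _ => .inr 1) (fun _ => .inr (-1))))
      (fun l => .inl ⟨a l.succ, a_ne l.succ⟩)
      (fun l => .inl (p l.succ)) (fun l => .inl (q l.succ))
      (fun l => .inl (p l.succ)) (fun l => .inl (q l.succ))
      (fun l => .inr (a l.succ)) (fun l => .inr (-a l.succ))
      (fun k l hkl => Fin.succ_injective _ (a_inj _ _ (by simpa using hkl)))
      ?_ ?_ ?_ ?_ ?_ ?_ ?_ ?_ (a := b) (by simpa using hb)
    · have hc : Fintype.card ({x : ZMod N // x ≠ 0} ⊕ (Unit ⊕ Unit)) = N + 1 := by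
        rw [Fintype.card_sum, Fintype.card_sum, hcard, Fintype.card_unit, hN]
      rwa [hc] at key
    · clear hA hA₁ hA₂ hp hq hinj
      rintro ((⟨k, hk⟩ | (k | k)) | (k | k)) ((⟨l, hl⟩ | (l | l)) | (l | l)) hh <;>
        simp [p, q] at hh ⊢ <;> clear p q <;> grind
    · clear hA hA₁ hA₂ hp hq hinj
      rintro ((⟨k, hk⟩ | (k | k)) | (k | k)) ((⟨l, hl⟩ | (l | l)) | (l | l)) hh <;>
        simp [p, q] at hh ⊢ <;> clear p q <;> grind
    · clear hA hA₁ hA₂ hp hq hinj p q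
      rintro ((⟨k, hk⟩ | (k | k)) | (k | k)) ((⟨l, hl⟩ | (l | l)) | (l | l)) hh <;>
        simp at hh ⊢ <;> grind
    · rintro (⟨k, hk⟩ | (k | k))
      · simp [subtractionSquare, mt (hneg k) hk]; ring
      · simp [subtractionSquare]
      · simp [subtractionSquare]
    · intro l
      simp [hA, q, subtractionSquare]
    · intro l
      simp [subtractionSquare, q]; ring
    · intro l
      simp [subtractionSquare, q]; ring
    · intro x y hx hy
      obtain ⟨x, rfl⟩ : ∃ x', x = .inl x' := by
        rcases x with x | x
        · exact ⟨x, rfl⟩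
        · by_cases h0 : x = 0
          · exact absurd (by simp [h0]) (hx (.inr (.inr ())))
          · exact absurd rfl (hx (.inl ⟨x, h0⟩))
      obtain ⟨y, rfl⟩ : ∃ y', y = .inl y' := by
        rcases y with y | y
        · exact ⟨y, rfl⟩
        · by_cases h0 : y = 0
          · exact absurd (by simp [h0]) (hy (.inr (.inl ())))
          · exact absurd (by simp) (hy (.inl ⟨-y, by simpa using h0⟩))
      obtain ⟨z, hz⟩ := double_surj (A x y)
      exact ⟨.inl z, congrArg Sum.inl hz⟩
  intro ℓ hl hu
  obtain ⟨b, hb | hb⟩ : ∃ b, ℓ = N + 2 * b ∨ ℓ = N + 1 + 2 * b :=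
    ⟨(ℓ - N) / 2, by omega⟩
  · rw [hb]
    exact key₁ b (by omega)
  · rw [hb]
    exact key₂ b (by omega)

/-! ### Orders congruent to three modulo four -/

/-- A square of odd order over a commutative ring `Z` in which `2 * c = 1`. It has the idempotent
subsquare of midpoints `c * (x + y)`; the lower right block is obtained from the same subsquare by
moving its diagonal to a new row and a new column, and putting the second kind of symbols on the
new diagonal. The other two blocks hold the reflections `2 * x - y`. The square is symmetric and
idempotent. -/
def midpointSquare {Z : Type} [CommRing Z] [DecidableEq Z] (c : Z) :
    Z ⊕ Option Z → Z ⊕ Option Z → Z ⊕ Option Z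
  | .inl x, .inl y => .inl (c * (x + y))
  | .inl x, .inr none => .inr (some x)
  | .inl x, .inr (some y) => if x = y then .inr none else .inr (some (2 * x - y))
  | .inr none, .inl y => .inr (some y)
  | .inr (some x), .inl y => if y = x then .inr none else .inr (some (2 * y - x))
  | .inr none, .inr none => .inr none
  | .inr none, .inr (some y) => .inl y
  | .inr (some x), .inr none => .inl x
  | .inr (some x), .inr (some y) => if x = y then .inr (some x) else .inl (c * (x + y))

section

variable {Z : Type} [CommRing Z] [DecidableEq Z] {c : Z}

theorem midpointSquare_comm (x y : Z ⊕ Option Z) :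
    midpointSquare c x y = midpointSquare c y x := by
  rcases x with x | _ | x <;> rcases y with y | _ | y <;> simp only [midpointSquare, add_comm]
  split_ifs <;> simp_all

theorem midpointSquare_self (hc : 2 * c = 1) (x : Z ⊕ Option Z) : midpointSquare c x x = x := by
  rcases x with x | _ | x <;> simp only [midpointSquare, if_true]
  rw [← two_mul, ← mul_assoc, mul_comm c, hc, one_mul]

theorem midpointSquare_injective_right (hc : 2 * c = 1) (x : Z ⊕ Option Z) :
    Injective (midpointSquare c x) := by
  have h₁ : ∀ a b d : Z, 2 * a - d = 2 * b - d → a = b := fun a b d h => by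
    linear_combination c * h + (b - a) * hc
  have h₂ : ∀ a b : Z, 2 * a - b = b → a = b := fun a b h => h₁ a b b (by linear_combination h)
  rcases x with x | _ | x <;> rintro (y | _ | y) (z | _ | z) hyz <;>
    simp only [midpointSquare] at hyz <;> (try split_ifs at hyz) <;> grind

theorem midpointSquare_injective_left (hc : 2 * c = 1) (y : Z ⊕ Option Z) :
    Injective (fun x => midpointSquare c x y) := by
  simpa only [midpointSquare_comm _ y] using midpointSquare_injective_right hc y

end

set_option maxHeartbeats 1000000 in
/-- The exchanged cells are `(b, b + 2)` in the lower right block, where `b = 4 * l` with `l < h`, so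
that none of the elements `b` and `b + 2` coincide. -/
theorem LatinSquare.exists_omniversal_four_mul_add_three {h : ℕ} (h1 : 1 ≤ h) :
    ∃ L : LatinSquare (4 * h + 3), L.IsOmniversal := by
  obtain ⟨m, hm⟩ : ∃ m, m = 2 * h + 1 := ⟨_, rfl⟩
  have : NeZero m := ⟨by omega⟩
  have hdvd : ∀ a : ℕ, (a : ZMod m) = 0 → a < 2 * m → a = 0 ∨ a = m := by
    intro a ha hlt
    obtain ⟨q, rfl⟩ := (ZMod.natCast_eq_zero_iff _ _).1 ha
    have : q < 2 := by
      by_contra hq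
      have : m * 2 ≤ m * q := Nat.mul_le_mul_left m (by omega)
      omega
    interval_cases q <;> simp
  obtain ⟨c, hc⟩ : ∃ c : ZMod m, 2 * c = 1 := by
    refine ⟨(h + 1 : ℕ), ?_⟩
    have : ((2 * h + 1 : ℕ) : ZMod m) = 0 := by rw [← hm]; simp
    push_cast at this ⊢
    linear_combination this
  let b : Fin h → ZMod m := fun l => (4 * l.val : ℕ)
  have b_inj : ∀ k l, b k = b l → k = l := by
    have key : ∀ k l, k ≤ l → b k = b l → k = l := by
      intro k l hle hkl
      have := hdvd (4 * (l.val - k.val)) (by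
        have hb : ((4 * k.val : ℕ) : ZMod m) = (4 * l.val : ℕ) := hkl
        have : k.val ≤ l.val := hle
        push_cast [this] at hb ⊢
        linear_combination -hb) (by omega)
      have : k.val ≤ l.val := hle
      exact Fin.ext (by omega)
    intro k l hkl
    rcases le_total k l with hle | hle
    · exact key k l hle hkl
    · exact (key l k hle hkl.symm).symm
  have b_two : ∀ k l, b k ≠ b l + 2 := by
    intro k l hkl
    have hb : ((4 * k.val : ℕ) : ZMod m) = (4 * l.val : ℕ) + 2 := hkl
    rcases le_or_gt k.val l.val with hle | hle
    · have := hdvd (4 * (l.val - k.val) + 2) (by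
        push_cast [hle] at hb ⊢
        linear_combination -hb) (by omega)
      omega
    · have := hdvd (4 * (k.val - l.val) - 2) (by
        have h2 : 2 ≤ 4 * (k.val - l.val) := by omega
        push_cast [hle.le, h2] at hb ⊢
        linear_combination hb) (by omega)
      omega
  have hcard : Fintype.card (ZMod m ⊕ Option (ZMod m)) = 4 * h + 3 := by
    simp [ZMod.card]
    omega
  -- For this index, one of `b` and `b + 2` is `-1`, which is a symbol of the second initial partial
  -- transversal.
  let l₀ : Fin h := ⟨h / 2, by omega⟩
  have b_ne : ∀ l, l ≠ l₀ → b l + 1 ≠ 0 ∧ b l + 2 ≠ 0 ∧ b l + 3 ≠ 0 ∧ b l + 4 ≠ 0 := by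
    intro l hl
    have hl' : l.val ≠ h / 2 := fun h' => hl (Fin.ext h')
    have key : ∀ i : ℕ, 1 ≤ i → i ≤ 4 → b l + i = 0 → 4 * l.val + i = m := fun i hi1 hi4 hi => by
      have hb : ((4 * l.val : ℕ) : ZMod m) + i = 0 := hi
      have := hdvd (4 * l.val + i) (by push_cast at hb ⊢; exact hb) (by omega)
      omega
    refine ⟨fun hi => ?_, fun hi => ?_, fun hi => ?_, fun hi => ?_⟩
    · have := key 1 (by norm_num) (by norm_num) (by simpa using hi)
      omega
    · have := key 2 (by norm_num) (by norm_num) (by simpa using hi)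
      omega
    · have := key 3 (by norm_num) (by norm_num) (by simpa using hi)
      omega
    · have := key 4 (by norm_num) (by norm_num) (by simpa using hi)
      omega
  clear_value b
  have one_ne : (1 : ZMod m) ≠ 0 := fun h1 => by
    have := hdvd 1 (by simpa using h1) (by omega)
    omega
  have two_ne : (2 : ZMod m) ≠ 0 := fun h2 => by
    have := hdvd 2 (by simpa using h2) (by omega)
    omega
  refine LatinSquare.exists_omniversal_of_hasMaximal hcard hcard hcard (midpointSquare c)
    (midpointSquare_injective_right hc) (midpointSquare_injective_left hc) ?_
  have key₁ : ∀ a ≤ h, HasMaximal (midpointSquare c) (m + 1 + 2 * a) := by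
    intro a ha
    -- The unused rows and columns are those of the subsquare.
    have key := HasMaximal.of_exchange_le (f := midpointSquare c)
      (τ := ZMod m ⊕ Unit) (G := Fin h)
      (Sum.elim (fun x => .inr (some x)) (fun _ => .inr none))
      (Sum.elim (fun x => .inr (some (x + 2))) (fun _ => .inr none))
      (Sum.elim (fun x => .inl (x + 1)) (fun _ => .inr none))
      (fun l => .inl (b l))
      (fun l => .inl (b l - 1)) (fun l => .inl (b l + 1))
      (fun l => .inl (b l + 3)) (fun l => .inl (b l + 1))
      (fun l => .inr (some (b l))) (fun l => .inr (some (b l + 2)))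
      (fun k l hkl => b_inj k l (by simpa using hkl))
      ?_ ?_ ?_ ?_ ?_ ?_ ?_ ?_ (a := a) (by simpa using ha)
    · simpa using key
    · clear hdvd b_ne
      rintro ((k | k) | (k | k)) ((l | l) | (l | l)) hh <;> simp at hh ⊢ <;> grind
    · clear hdvd b_ne
      rintro ((k | k) | (k | k)) ((l | l) | (l | l)) hh <;> simp at hh ⊢ <;> grind
    · clear hdvd b_ne
      rintro ((k | k) | (k | k)) ((l | l) | (l | l)) hh <;> simp at hh ⊢ <;> grind
    · rintro (k | k)
      · simp [midpointSquare, two_ne]; linear_combination (k + 1) * hc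
      · simp [midpointSquare]
    · intro l
      simp [midpointSquare]; linear_combination (b l + 1) * hc
    · intro l
      have : b l + 1 ≠ b l + 2 := fun h => one_ne (by linear_combination -h)
      simp [midpointSquare, this]; ring
    · intro l
      simp [midpointSquare, one_ne]; ring
    · intro x y hx hy
      obtain ⟨x, rfl⟩ : ∃ x', x = .inl x' := by
        rcases x with x | _ | x
        · exact ⟨x, rfl⟩
        · exact absurd rfl (hx (.inr ()))
        · exact absurd rfl (hx (.inl x))
      obtain ⟨y, rfl⟩ : ∃ y', y = .inl y' := by
        rcases y with y | _ | y
        · exact ⟨y, rfl⟩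
        · exact absurd rfl (hy (.inr ()))
        · exact absurd (by simp) (hy (.inl (y - 2)))
      exact ⟨.inl (c * (x + y) - 1), by simp [midpointSquare]⟩
  have key₂ : ∀ a ≤ h - 1, HasMaximal (midpointSquare c) (m + 2 + 2 * a) := by
    intro a ha
    -- The last cell on the diagonal makes way for the two cells in its row and its column that meet
    -- the column `-1` and the row `-2` of the subsquare.
    have key := HasMaximal.of_exchange_le (f := midpointSquare c)
      (τ := ZMod m ⊕ (Unit ⊕ Unit)) (G := {l : Fin h // l ≠ l₀})
      (Sum.elim (fun x => .inr (some x)) (Sum.elim (fun _ => .inl (-2)) (fun _ => .inr none)))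
      (Sum.elim (fun x => .inr (some (x + 2)))
        (Sum.elim (fun _ => .inr none) (fun _ => .inl (-1))))
      (Sum.elim (fun x => .inl (x + 1))
        (Sum.elim (fun _ => .inr (some (-2))) (fun _ => .inr (some (-1)))))
      (fun l => .inl (b l))
      (fun l => .inl (b l - 1)) (fun l => .inl (b l + 1))
      (fun l => .inl (b l + 3)) (fun l => .inl (b l + 1))
      (fun l => .inr (some (b l))) (fun l => .inr (some (b l + 2)))
      (fun k l hkl => Subtype.ext (b_inj k l (by simpa using hkl)))
      ?_ ?_ ?_ ?_ ?_ ?_ ?_ ?_ (a := a) (by simpa [Fintype.card_subtype_compl] using ha)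
    · simpa using key
    · clear hdvd
      rintro ((k | (k | k)) | (⟨k, hk⟩ | ⟨k, hk⟩)) ((l | (l | l)) | (⟨l, hl⟩ | ⟨l, hl⟩)) hh <;>
        simp at hh ⊢ <;> grind
    · clear hdvd
      rintro ((k | (k | k)) | (⟨k, hk⟩ | ⟨k, hk⟩)) ((l | (l | l)) | (⟨l, hl⟩ | ⟨l, hl⟩)) hh <;>
        simp at hh ⊢ <;> grind
    · clear hdvd
      rintro ((k | (k | k)) | (⟨k, hk⟩ | ⟨k, hk⟩)) ((l | (l | l)) | (⟨l, hl⟩ | ⟨l, hl⟩)) hh <;>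
        simp at hh ⊢ <;> grind
    · rintro (k | (k | k))
      · simp [midpointSquare, two_ne]; linear_combination (k + 1) * hc
      · simp [midpointSquare]
      · simp [midpointSquare]
    · intro l
      simp [midpointSquare]; linear_combination (b l + 1) * hc
    · intro l
      have : b l + 1 ≠ b l + 2 := fun h => one_ne (by linear_combination -h)
      simp [midpointSquare, this]; ring
    · intro l
      simp [midpointSquare, one_ne]; ring
    · intro x y hx hy
      obtain ⟨x, rfl⟩ : ∃ x', x = .inl x' := by
        rcases x with x | _ | x
        · exact ⟨x, rfl⟩
        · exact absurd rfl (hx (.inr (.inr ())))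
        · exact absurd rfl (hx (.inl x))
      obtain ⟨y, rfl⟩ : ∃ y', y = .inl y' := by
        rcases y with y | _ | y
        · exact ⟨y, rfl⟩
        · exact absurd rfl (hy (.inr (.inl ())))
        · exact absurd (by simp) (hy (.inl (y - 2)))
      exact ⟨.inl (c * (x + y) - 1), by simp [midpointSquare]⟩
  have key₃ : HasMaximal (midpointSquare c) (4 * h + 3) := by
    refine ⟨_, inferInstance, id, id, hcard, injective_id, injective_id, ?_, ?_⟩
    · simp only [id, midpointSquare_self hc]
      exact injective_id
    · exact fun x _ hx => absurd rfl (hx x)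
  intro ℓ hl hu
  obtain ⟨a, ha | ha⟩ : ∃ a, ℓ = m + 1 + 2 * a ∨ ℓ = m + 2 + 2 * a :=
    ⟨(ℓ - (m + 1)) / 2, by omega⟩
  · rw [ha]
    exact key₁ a (by omega)
  · rcases hu.eq_or_lt with rfl | hu
    · exact key₃
    · rw [ha]
      exact key₂ a (by omega)

/-! ### Nonexistence -/

namespace LatinSquare

variable {n : ℕ} {L : LatinSquare n} {T : Finset (Fin n × Fin n × Fin n)}

theorem entry_injective_right (L : LatinSquare n) (r : Fin n) : Injective (L.entry r) :=
  fun _ _ h => (L.row_latin r _).unique h rfl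

theorem entry_injective_left (L : LatinSquare n) (c : Fin n) :
    Injective (fun r => L.entry r c) :=
  fun _ _ h => (L.col_latin c _).unique h rfl

/-- A partial transversal lies on the graph of a permutation. -/
theorem IsPartialTransversal.exists_perm (hT : L.IsPartialTransversal T) :
    ∃ p : Equiv.Perm (Fin n), ∀ t ∈ T, p t.1 = t.2.1 := by
  obtain ⟨p, hp⟩ := Fintype.exists_equiv_apply_eq rfl (fun t : T => t.1.1) (fun t : T => t.1.2.1)
    (fun t u h => Subtype.ext (hT.row _ t.2 _ u.2 h))
    (fun t u h => Subtype.ext (hT.col _ t.2 _ u.2 h))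
  exact ⟨p, fun t ht => hp ⟨t, ht⟩⟩

theorem IsPartialTransversal.card_image_row (hT : L.IsPartialTransversal T) :
    (T.image fun t => t.1).card = T.card :=
  Finset.card_image_of_injOn fun t ht u hu h => hT.row t ht u hu h

theorem IsPartialTransversal.card_image_col (hT : L.IsPartialTransversal T) :
    (T.image fun t => t.2.1).card = T.card :=
  Finset.card_image_of_injOn fun t ht u hu h => hT.col t ht u hu h

theorem IsPartialTransversal.card_image_symbol (hT : L.IsPartialTransversal T) :
    (T.image fun t => t.2.2).card = T.card :=
  Finset.card_image_of_injOn fun t ht u hu h => hT.symbol t ht u hu h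

/-- In a maximal partial transversal, a cell in an unused row and an unused column contains a
symbol which is already used. -/
theorem IsMaximalPartialTransversal.exists_symbol_eq (hT : L.IsMaximalPartialTransversal T)
    {r c : Fin n} (hr : ∀ t ∈ T, t.1 ≠ r) (hc : ∀ t ∈ T, t.2.1 ≠ c) :
    ∃ t ∈ T, t.2.2 = L.entry r c := by
  by_contra! hs
  have hnot : (r, c, L.entry r c) ∉ T := fun h => hr _ h rfl
  refine hT.2 ⟨insert (r, c, L.entry r c) T, ⟨?_, ?_, ?_, ?_⟩, Finset.subset_insert _ _, ?_⟩
  · intro t ht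
    rcases Finset.mem_insert.1 ht with rfl | ht
    · rfl
    · exact hT.1.subset t ht
  · intro t ht u hu h
    rcases Finset.mem_insert.1 ht with rfl | ht <;> rcases Finset.mem_insert.1 hu with rfl | hu
    · rfl
    · exact absurd h.symm (hr u hu)
    · exact absurd h (hr t ht)
    · exact hT.1.row t ht u hu h
  · intro t ht u hu h
    rcases Finset.mem_insert.1 ht with rfl | ht <;> rcases Finset.mem_insert.1 hu with rfl | hu
    · rfl
    · exact absurd h.symm (hc u hu)
    · exact absurd h (hc t ht)
    · exact hT.1.col t ht u hu h
  · intro t ht u hu h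
    rcases Finset.mem_insert.1 ht with rfl | ht <;> rcases Finset.mem_insert.1 hu with rfl | hu
    · rfl
    · exact absurd h.symm (hs u hu)
    · exact absurd h (hs t ht)
    · exact hT.1.symbol t ht u hu h
  · rw [Finset.card_insert_of_notMem hnot]
    exact Nat.lt_succ_self _

theorem IsPartialTransversal.exists_perm_injective (hT : L.IsPartialTransversal T)
    (hcard : T.card = n) : ∃ p : Equiv.Perm (Fin n), Injective fun r => L.entry r (p r) := by
  obtain ⟨p, hp⟩ := hT.exists_perm
  have huniv : T.image (fun t => t.1) = Finset.univ :=
    Finset.eq_univ_of_card _ (by rw [hT.card_image_row, hcard, Fintype.card_fin])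
  have hrow : ∀ r, ∃ t ∈ T, t.1 = r := fun r => by
    have : r ∈ T.image (fun t => t.1) := huniv ▸ Finset.mem_univ r
    simpa using this
  refine ⟨p, fun r r' h => ?_⟩
  obtain ⟨t, ht, rfl⟩ := hrow r
  obtain ⟨u, hu, rfl⟩ := hrow r'
  have h1 : L.entry t.1 t.2.1 = t.2.2 := hT.subset t ht
  have h2 : L.entry u.1 u.2.1 = u.2.2 := hT.subset u hu
  simp only [hp t ht, hp u hu, h1, h2] at h
  rw [hT.symbol t ht u hu h]

/-- A maximal partial transversal of length one less than the order, as a permutation `p` whose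
cells have different symbols except for the one in row `r`. -/
theorem IsMaximalPartialTransversal.exists_perm_not_injective
    (hT : L.IsMaximalPartialTransversal T) (hcard : T.card + 1 = n) :
    ∃ (p : Equiv.Perm (Fin n)) (r : Fin n),
      (∀ i j, i ≠ r → j ≠ r → L.entry i (p i) = L.entry j (p j) → i = j) ∧
      ∃ i, i ≠ r ∧ L.entry i (p i) = L.entry r (p r) := by
  obtain ⟨p, hp⟩ := hT.1.exists_perm
  have h1 : (T.image (fun t => t.1))ᶜ.card = 1 := by
    rw [Finset.card_compl, hT.1.card_image_row, Fintype.card_fin]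
    omega
  obtain ⟨r, hr⟩ := Finset.card_eq_one.1 h1
  have hrow : ∀ i, i ≠ r ↔ ∃ t ∈ T, t.1 = i := fun i => by
    have : i ∈ (T.image (fun t => t.1))ᶜ ↔ i = r := by rw [hr, Finset.mem_singleton]
    rw [Finset.mem_compl] at this
    rw [← not_iff_not, not_not, ← this]
    simp
  have hsym : ∀ t ∈ T, L.entry t.1 (p t.1) = t.2.2 := fun t ht => by
    rw [hp t ht]
    exact hT.1.subset t ht
  refine ⟨p, r, fun i j hi hj hij => ?_, ?_⟩
  · obtain ⟨t, ht, rfl⟩ := (hrow i).1 hi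
    obtain ⟨u, hu, rfl⟩ := (hrow j).1 hj
    rw [hsym t ht, hsym u hu] at hij
    rw [hT.1.symbol t ht u hu hij]
  · have hr' : ∀ t ∈ T, t.1 ≠ r := fun t ht => (hrow _).2 ⟨t, ht, rfl⟩
    obtain ⟨t, ht, hts⟩ := hT.exists_symbol_eq (r := r) (c := p r) hr' fun t ht h =>
      hr' t ht (p.injective ((hp t ht).trans h))
    exact ⟨t.1, hr' t ht, by rw [hsym t ht, hts]⟩

/-- A maximal partial transversal of half the order splits the square into four subsquares. -/
theorem IsMaximalPartialTransversal.exists_blocks {m : ℕ} (hn : n = 2 * m)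
    (hT : L.IsMaximalPartialTransversal T) (hcard : T.card = m) :
    ∃ A B S : Finset (Fin n), A.card = m ∧ B.card = m ∧ S.card = m ∧
      ∀ r c, L.entry r c ∈ S ↔ (r ∈ A ↔ c ∈ B) := by
  let A := (T.image fun t => t.1)ᶜ
  let B := (T.image fun t => t.2.1)ᶜ
  let S := T.image fun t => t.2.2
  have hA : A.card = m := by
    rw [Finset.card_compl, hT.1.card_image_row, Fintype.card_fin]
    omega
  have hB : B.card = m := by
    rw [Finset.card_compl, hT.1.card_image_col, Fintype.card_fin]
    omega
  have hS : S.card = m := by rw [hT.1.card_image_symbol, hcard]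
  have hABS : ∀ r ∈ A, ∀ c ∈ B, L.entry r c ∈ S := fun r hr c hc => by
    obtain ⟨t, ht, h⟩ := hT.exists_symbol_eq (r := r) (c := c)
      (fun t ht h => Finset.mem_compl.1 hr (Finset.mem_image.2 ⟨t, ht, h⟩))
      (fun t ht h => Finset.mem_compl.1 hc (Finset.mem_image.2 ⟨t, ht, h⟩))
    exact h ▸ Finset.mem_image_of_mem _ ht
  clear_value A B S
  -- An injective map that sends one set into another one of the same size pulls it back exactly.
  have pull : ∀ (g : Fin n → Fin n) (X Y : Finset (Fin n)), Injective g → X.card = Y.card →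
      (∀ x ∈ X, g x ∈ Y) → ∀ x, g x ∈ Y → x ∈ X := by
    intro g X Y hg hXY hmaps x hx
    have : X.image g = Y := Finset.eq_of_subset_of_card_le
      (fun y hy => by obtain ⟨x, hx, rfl⟩ := Finset.mem_image.1 hy; exact hmaps x hx)
      (by rw [Finset.card_image_of_injective _ hg, hXY])
    rw [← this] at hx
    obtain ⟨x', hx', h⟩ := Finset.mem_image.1 hx
    exact hg h ▸ hx'
  refine ⟨A, B, S, hA, hB, hS, fun r c => ?_⟩
  have h1 : ∀ r ∈ A, ∀ c, L.entry r c ∈ S → c ∈ B := fun r hr =>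
    pull _ B S (L.entry_injective_right r) (hB.trans hS.symm) (hABS r hr)
  have h2 : ∀ c ∈ B, ∀ r, L.entry r c ∈ S → r ∈ A := fun c hc =>
    pull _ A S (L.entry_injective_left c) (hA.trans hS.symm) fun r hr => hABS r hr c hc
  have h3 : ∀ r, r ∉ A → ∀ c, L.entry r c ∈ Sᶜ → c ∈ B := fun r hr =>
    pull _ B Sᶜ (L.entry_injective_right r) (by
      rw [Finset.card_compl, Fintype.card_fin]
      omega) fun c hc => Finset.mem_compl.2 fun hS => hr (h2 c hc r hS)
  by_cases hr : r ∈ A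
  · simp only [hr, true_iff]
    exact ⟨h1 r hr c, hABS r hr c⟩
  · simp only [hr, false_iff]
    exact ⟨fun hS hc => hr (h2 c hc r hS), fun hc => by
      by_contra hS
      exact hc (h3 r hr c (Finset.mem_compl.2 hS))⟩

/-- A square split into four subsquares of order `m` has no transversal if `m` is odd: a transversal
meets the two diagonal subsquares in equally many cells, and in `m` cells altogether. -/
theorem even_of_blocks {m : ℕ} (hn : n = 2 * m) {A B S : Finset (Fin n)} (hA : A.card = m)
    (hB : B.card = m) (hS : S.card = m) (h : ∀ r c, L.entry r c ∈ S ↔ (r ∈ A ↔ c ∈ B))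
    (p : Equiv.Perm (Fin n)) (hp : Injective fun r => L.entry r (p r)) : Even m := by
  have hcount : (Finset.univ.filter fun r => (r ∈ A ↔ p r ∈ B)).card = m := by
    have hbij := Finite.injective_iff_bijective.1 hp
    rw [← hS]
    refine Finset.card_bij (fun r _ => L.entry r (p r)) (fun r hr => ?_)
      (fun r _ r' _ hrr => hp hrr) fun s hs => ?_
    · exact (h r (p r)).2 (Finset.mem_filter.1 hr).2
    · obtain ⟨r, rfl⟩ := hbij.2 s
      exact ⟨r, Finset.mem_filter.2 ⟨Finset.mem_univ _, (h r (p r)).1 hs⟩, rfl⟩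
  have hB' : (B.map p.symm.toEmbedding).card = m := by rw [Finset.card_map, hB]
  have hmem : ∀ r, r ∈ B.map p.symm.toEmbedding ↔ p r ∈ B := fun r => by simp
  generalize B.map p.symm.toEmbedding = B' at hB' hmem
  have hsplit : (Finset.univ.filter fun r => (r ∈ A ↔ p r ∈ B)) = (A ∩ B') ∪ (A ∪ B')ᶜ := by
    ext r
    simp only [Finset.mem_filter, Finset.mem_univ, true_and, Finset.mem_union, Finset.mem_inter,
      Finset.mem_compl, hmem]
    tauto
  have hdisj : Disjoint (A ∩ B') (A ∪ B')ᶜ := by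
    rw [Finset.disjoint_left]
    intro r hr hr'
    exact Finset.mem_compl.1 hr' (Finset.mem_union_left _ (Finset.mem_inter.1 hr).1)
  rw [hsplit, Finset.card_union_of_disjoint hdisj, Finset.card_compl, Fintype.card_fin] at hcount
  have := Finset.card_union_add_card_inter A B'
  exact ⟨(A ∩ B').card, by omega⟩

theorem not_isOmniversal_of_mod_four (L : LatinSquare n) (hn : n % 4 = 2) : ¬ L.IsOmniversal := by
  intro hL
  obtain ⟨m, rfl⟩ : ∃ m, n = 2 * m := ⟨n / 2, by omega⟩
  obtain ⟨T, hT, hTc⟩ := hL m (Nat.ceil_le.2 (by push_cast; linarith)) (by omega)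
  obtain ⟨A, B, S, hA, hB, hS, h⟩ := hT.exists_blocks rfl hTc
  obtain ⟨T', hT', hTc'⟩ := hL (2 * m) (Nat.ceil_le.2 (by push_cast; linarith)) le_rfl
  obtain ⟨p, hp⟩ := hT'.1.exists_perm_injective hTc'
  obtain ⟨a, ha⟩ := even_of_blocks rfl hA hB hS h p hp
  omega

theorem not_isOmniversal_three (L : LatinSquare 3) : ¬ L.IsOmniversal := by
  intro hL
  obtain ⟨T, hT, hTc⟩ := hL 2 (Nat.ceil_le.2 (by norm_num)) (by omega)
  obtain ⟨p, r, hinj, i, hir, hi⟩ := hT.exists_perm_not_injective (by omega)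
  obtain ⟨j, hji, hjr⟩ : ∃ j, j ≠ i ∧ j ≠ r := by
    clear hi hinj
    revert i r
    decide
  -- In row `j`, the cells in columns `p i` and `p r` would both hold the one symbol that is missing
  -- from the cells `(i, p i)` and `(j, p j)`.
  have h1 : L.entry j (p j) ≠ L.entry i (p i) := fun h => hji (hinj j i hjr hir h)
  have h2 : L.entry j (p r) ≠ L.entry r (p r) := (L.entry_injective_left (p r)).ne hjr
  have h3 : L.entry j (p i) ≠ L.entry i (p i) := (L.entry_injective_left (p i)).ne hji
  have h4 : L.entry j (p r) ≠ L.entry j (p j) :=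
    (L.entry_injective_right j).ne (p.injective.ne hjr.symm)
  have h5 : L.entry j (p i) ≠ L.entry j (p j) :=
    (L.entry_injective_right j).ne (p.injective.ne hji.symm)
  have h6 : L.entry j (p i) ≠ L.entry j (p r) :=
    (L.entry_injective_right j).ne (p.injective.ne hir)
  rw [← hi] at h2
  omega

/-- The squares of order four that are split into four subsquares of order two, namely
`{0, 1} × {0, 1}` and its three complementary blocks; each `Bool` chooses one of the two possible
subsquares. -/
def blockSquare (a b c d : Bool) : Fin 4 → Fin 4 → Fin 4 :=
  let x (e : Bool) : Fin 4 := if e then 1 else 0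
  let y (e : Bool) : Fin 4 := if e then 3 else 2
  ![![x a, x !a, y b, y !b], ![x !a, x a, y !b, y b],
    ![y c, y !c, x d, x !d], ![y !c, y c, x !d, x d]]

set_option maxRecDepth 100000 in
/-- A block square with odd parity is isotopic to the cyclic group and has no transversal. -/
theorem blockSquare_xor_eq_false : ∀ a b c d : Bool, ∀ p₀ p₁, p₁ ≠ p₀ →
    ∀ p₂, p₂ ≠ p₀ → p₂ ≠ p₁ → ∀ p₃, p₃ ≠ p₀ → p₃ ≠ p₁ → p₃ ≠ p₂ →
    (∀ i j, blockSquare a b c d i (![p₀, p₁, p₂, p₃] i) =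
      blockSquare a b c d j (![p₀, p₁, p₂, p₃] j) → i = j) →
    (a ^^ b ^^ c ^^ d) = false := by
  decide

set_option maxRecDepth 100000 in
/-- A block square with even parity is isotopic to the Klein four-group, and all its partial
transversals of length three extend. -/
theorem blockSquare_ne : ∀ a b c d : Bool, (a ^^ b ^^ c ^^ d) = false → ∀ p₀ p₁, p₁ ≠ p₀ →
    ∀ p₂, p₂ ≠ p₀ → p₂ ≠ p₁ → ∀ p₃, p₃ ≠ p₀ → p₃ ≠ p₁ → p₃ ≠ p₂ → ∀ r,
    (∀ i j, i ≠ r → j ≠ r → blockSquare a b c d i (![p₀, p₁, p₂, p₃] i) =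
      blockSquare a b c d j (![p₀, p₁, p₂, p₃] j) → i = j) →
    ∀ i, i ≠ r → blockSquare a b c d i (![p₀, p₁, p₂, p₃] i) ≠
      blockSquare a b c d r (![p₀, p₁, p₂, p₃] r) := by
  decide

theorem exists_low_block : ∀ w x y z : Fin 4, w < 2 → x < 2 → y < 2 → z < 2 → w ≠ x → w ≠ y →
    x ≠ z → ∃ e : Bool, w = (if e then 1 else 0) ∧ x = (if !e then 1 else 0) ∧
      y = (if !e then 1 else 0) ∧ z = (if e then 1 else 0) := by
  decide

theorem exists_high_block : ∀ w x y z : Fin 4, ¬ w < 2 → ¬ x < 2 → ¬ y < 2 → ¬ z < 2 → w ≠ x →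
    w ≠ y → x ≠ z → ∃ e : Bool, w = (if e then 3 else 2) ∧ x = (if !e then 3 else 2) ∧
      y = (if !e then 3 else 2) ∧ z = (if e then 3 else 2) := by
  decide

theorem exists_eq_blockSquare {f : Fin 4 → Fin 4 → Fin 4} (hrow : ∀ i, Injective (f i))
    (hcol : ∀ j, Injective (fun i => f i j)) (hf : ∀ i j, f i j < 2 ↔ (i < 2 ↔ j < 2)) :
    ∃ a b c d, f = blockSquare a b c d := by
  have hr : ∀ i j j', j ≠ j' → f i j ≠ f i j' := fun i j j' h => (hrow i).ne h
  have hc : ∀ j i i', i ≠ i' → f i j ≠ f i' j := fun j i i' h => (hcol j).ne h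
  have low : ∀ i j, (i < 2 ↔ j < 2) → f i j < 2 := fun i j => (hf i j).2
  have high : ∀ i j, ¬ (i < 2 ↔ j < 2) → ¬ f i j < 2 := fun i j => mt (hf i j).1
  obtain ⟨a, ha⟩ := exists_low_block (f 0 0) (f 0 1) (f 1 0) (f 1 1)
    (low _ _ (by decide)) (low _ _ (by decide)) (low _ _ (by decide)) (low _ _ (by decide))
    (hr _ _ _ (by decide)) (hc _ _ _ (by decide)) (hc _ _ _ (by decide))
  obtain ⟨b, hb⟩ := exists_high_block (f 0 2) (f 0 3) (f 1 2) (f 1 3)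
    (high _ _ (by decide)) (high _ _ (by decide)) (high _ _ (by decide)) (high _ _ (by decide))
    (hr _ _ _ (by decide)) (hc _ _ _ (by decide)) (hc _ _ _ (by decide))
  obtain ⟨c, hc'⟩ := exists_high_block (f 2 0) (f 2 1) (f 3 0) (f 3 1)
    (high _ _ (by decide)) (high _ _ (by decide)) (high _ _ (by decide)) (high _ _ (by decide))
    (hr _ _ _ (by decide)) (hc _ _ _ (by decide)) (hc _ _ _ (by decide))
  obtain ⟨d, hd⟩ := exists_low_block (f 2 2) (f 2 3) (f 3 2) (f 3 3)
    (low _ _ (by decide)) (low _ _ (by decide)) (low _ _ (by decide)) (low _ _ (by decide))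
    (hr _ _ _ (by decide)) (hc _ _ _ (by decide)) (hc _ _ _ (by decide))
  refine ⟨a, b, c, d, ?_⟩
  funext i j
  fin_cases i <;> fin_cases j <;> simp only [blockSquare] <;>
    first | exact ha.1 | exact ha.2.1 | exact ha.2.2.1 | exact ha.2.2.2
          | exact hb.1 | exact hb.2.1 | exact hb.2.2.1 | exact hb.2.2.2
          | exact hc'.1 | exact hc'.2.1 | exact hc'.2.2.1 | exact hc'.2.2.2
          | exact hd.1 | exact hd.2.1 | exact hd.2.2.1 | exact hd.2.2.2

theorem exists_perm_mem_iff_lt_two (A : Finset (Fin 4)) (hA : A.card = 2) :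
    ∃ ρ : Equiv.Perm (Fin 4), ∀ i, ρ i ∈ A ↔ i < 2 := by
  obtain ⟨ρ, hρ⟩ := Fintype.exists_equiv_apply_eq rfl (Fin.castLE (by norm_num : 2 ≤ 4))
    (A.orderEmbOfFin hA) (Fin.castLE_injective _) (A.orderEmbOfFin hA).injective
  refine ⟨ρ, fun i => ⟨fun hi => ?_, fun hi => ?_⟩⟩
  · have : ρ i ∈ Set.range (A.orderEmbOfFin hA) := by
      rw [Finset.range_orderEmbOfFin]
      exact hi
    obtain ⟨k, hk⟩ := this
    rw [← hρ] at hk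
    rw [← ρ.injective hk]
    exact k.2
  · have : ρ i = A.orderEmbOfFin hA ⟨i, hi⟩ := hρ ⟨i, hi⟩
    rw [this]
    exact Finset.orderEmbOfFin_mem _ _ _

/-- The square is isotopic to the Cayley table of the cyclic group of order four or to that of the
Klein four-group. The former has no transversal, and in the latter every partial transversal of
length three extends. -/
theorem not_isOmniversal_four (L : LatinSquare 4) : ¬ L.IsOmniversal := by
  intro hL
  obtain ⟨T, hT, hTc⟩ := hL 2 (Nat.ceil_le.2 (by norm_num)) (by omega)
  obtain ⟨A, B, S, hA, hB, hS, h⟩ := hT.exists_blocks (m := 2) rfl hTc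
  obtain ⟨T₃, hT₃, hTc₃⟩ := hL 3 (Nat.ceil_le.2 (by norm_num)) (by omega)
  obtain ⟨p, r, hinj, i, hir, hi⟩ := hT₃.exists_perm_not_injective (by omega)
  obtain ⟨T₄, hT₄, hTc₄⟩ := hL 4 (Nat.ceil_le.2 (by norm_num)) (by omega)
  obtain ⟨q, hq⟩ := hT₄.1.exists_perm_injective hTc₄
  obtain ⟨ρ, hρ⟩ := exists_perm_mem_iff_lt_two A hA
  obtain ⟨κ, hκ⟩ := exists_perm_mem_iff_lt_two B hB
  obtain ⟨σ, hσ⟩ := exists_perm_mem_iff_lt_two S hS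
  obtain ⟨a, b, c, d, hf⟩ := exists_eq_blockSquare
    (f := fun i j => σ.symm (L.entry (ρ i) (κ j)))
    (fun i => σ.symm.injective.comp ((L.entry_injective_right _).comp κ.injective))
    (fun j => σ.symm.injective.comp ((L.entry_injective_left _).comp ρ.injective))
    (fun i j => by rw [← hσ, Equiv.apply_symm_apply, h, hρ, hκ])
  -- A permutation for `L`, rewritten as one for the block square.
  let π (p : Equiv.Perm (Fin 4)) : Equiv.Perm (Fin 4) := (ρ.trans p).trans κ.symm
  have hvec : ∀ p i, ![π p 0, π p 1, π p 2, π p 3] i = κ.symm (p (ρ i)) := fun p i => by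
    fin_cases i <;> rfl
  have hval : ∀ p i, blockSquare a b c d i (![π p 0, π p 1, π p 2, π p 3] i) =
      σ.symm (L.entry (ρ i) (p (ρ i))) := fun p i => by
    rw [hvec, ← hf]
    simp
  have hne : ∀ p i j, i ≠ j → π p i ≠ π p j := fun p i j hij => (π p).injective.ne hij
  have hxor := blockSquare_xor_eq_false a b c d (π q 0) (π q 1) (hne _ _ _ (by decide)) (π q 2)
    (hne _ _ _ (by decide)) (hne _ _ _ (by decide)) (π q 3) (hne _ _ _ (by decide))
    (hne _ _ _ (by decide)) (hne _ _ _ (by decide)) fun i j hij => by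
      rw [hval, hval] at hij
      exact ρ.injective (hq (σ.symm.injective hij))
  refine blockSquare_ne a b c d hxor (π p 0) (π p 1) (hne _ _ _ (by decide)) (π p 2)
    (hne _ _ _ (by decide)) (hne _ _ _ (by decide)) (π p 3) (hne _ _ _ (by decide))
    (hne _ _ _ (by decide)) (hne _ _ _ (by decide)) (ρ.symm r) (fun i j hi hj hij => ?_)
    (ρ.symm i) (ρ.symm.injective.ne hir) ?_
  · rw [hval, hval] at hij
    exact ρ.injective (hinj _ _ (fun h => hi (by rw [← h, Equiv.symm_apply_apply]))
      (fun h => hj (by rw [← h, Equiv.symm_apply_apply])) (σ.symm.injective hij))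
  · rw [hval, hval, Equiv.apply_symm_apply, Equiv.apply_symm_apply, hi]

/-! ### The characterization -/

/-- In orders zero and one, the whole square is a partial transversal. -/
theorem exists_omniversal_of_le_one (hn : n ≤ 1) : ∃ L : LatinSquare n, L.IsOmniversal := by
  have : Subsingleton (Fin n) := Fin.subsingleton_iff_le_one.2 hn
  refine exists_omniversal_of_hasMaximal (Fintype.card_fin n) (Fintype.card_fin n)
    (Fintype.card_fin n) (fun x _ => x) (fun _ => injective_of_subsingleton _)
    (fun _ => injective_of_subsingleton _) fun ℓ hl hu => ?_
  have hln : ℓ = n := by omega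
  exact ⟨Fin n, inferInstance, id, id, by rw [Fintype.card_fin, hln], injective_id, injective_id,
    injective_id, fun x _ hx => absurd rfl (hx x)⟩

end LatinSquare

theorem theorem1p3 (n : ℕ) :
    (∃ L : LatinSquare n, L.IsOmniversal) ↔ (n ∉ ({3, 4} : Set ℕ) ∧ ¬ n ≡ 2 [MOD 4]) := by
  constructor
  · rintro ⟨L, hL⟩
    refine ⟨?_, fun h => L.not_isOmniversal_of_mod_four h hL⟩
    rintro (rfl | rfl)
    · exact L.not_isOmniversal_three hL
    · exact L.not_isOmniversal_four hL
  · rintro ⟨h34, h2⟩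
    have h3 : n ≠ 3 := fun h => h34 (by simp [h])
    have h4 : n ≠ 4 := fun h => h34 (by simp [h])
    have h2' : n % 4 ≠ 2 := h2
    rcases Nat.lt_or_ge n 2 with hn | hn
    · exact LatinSquare.exists_omniversal_of_le_one (by omega)
    obtain ⟨h, rfl | rfl | rfl⟩ : ∃ h, n = 4 * (h + 2) ∨ n = 4 * h + 5 ∨ n = 4 * (h + 1) + 3 := by
      rcases (by omega : n % 4 = 0 ∨ n % 4 = 1 ∨ n % 4 = 3) with h | h | h
      · exact ⟨n / 4 - 2, by omega⟩
      · exact ⟨n / 4 - 1, by omega⟩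
      · exact ⟨n / 4 - 1, by omega⟩
    · exact LatinSquare.exists_omniversal_four_mul (by omega)
    · exact LatinSquare.exists_omniversal_four_mul_add_five h
    · exact LatinSquare.exists_omniversal_four_mul_add_three (by omega)
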